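/- Fix a finite relational schema $S$ (relation names with arities) and a domain $\mathcal U$ of constants with a linear order. Constants are represented by an injective encoding $\mathrm{enc}:\mathcal U\to\{0,1\}^*$ under which $a<b$ is decidable in polynomial time (Turing machines). A database instance is a finite set of ground atoms $R(\bar c)$ over $S$ and $\mathcal U$. Sentences are first-order sentences built from the relation names, the constants in $\mathcal U$ and the comparison predicates $=,\neq,<,\le,>,\ge$. A denial constraint is a sentence $\forall\bar x\,\neg(A_1\wedge\dots\wedge A_k\wedge\gamma)$ with database atoms $A_i$ and a conjunction $\gamma$ of comparison atoms. Given a finite set $IC$ of denial constraints, a C-repair of an instance $D$ is an instance $D'$ with $D'\models IC$ such that no instance $D''\models IC$ has $|D''\,\triangle\, D|<|D'\,\triangle\, D|$; here $\triangle$ is the symmetric difference. An update operation is $\mathrm{insert}(R(\bar c))$, $\mathrm{delete}(R(\bar c))$ or $\mathrm{change}(R(\bar c),A,a)$ (the value of attribute $A$ in the tuple $R(\bar c)$ becomes $a$); deleting or changing an absent tuple has no effect. For a sequence $U$ of updates, $U(D)$ is the result of applying them to $D$ in order. Theorem. Let $IC$ be a finite set of denial constraints, $Q$ a first-order sentence (a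 boolean query) and $m\in\mathbb N$, all fixed. Consider the decision problem: given an instance $D$ (as a list of its tuples) and an update sequence $U$, decide whether $D\models IC$, $U$ has length $m$, and $D'\models Q$ for every C-repair $D'$ of $U(D)$ with respect to $IC$. This problem is in PTIME: it is decided by a Turing machine in time polynomial in the length of the encoding of $(D,U)$ (so, the $m$ updates counting as a constant, polynomial in $|D|$). This holds (i) under the active-domain semantics of $\models$, for all $IC$ and $Q$: in evaluating a sentence in an instance, quantifiers range over the constants that occur in the instance or in the sentence; (ii) under the natural semantics of $\models$, where quantifiers range over all of $\mathcal U$, if $Q$ and the constraints in $IC$ are domain independent, that is, their truth value in an instance is the same for all quantifier ranges contained in $\mathcal U$ that contain the active domain of (i). -/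

import Mathlib

namespace IncCQA

open FirstOrder

/-! ### Schemas, facts, instances, updates -/

/-- A relational schema: finitely many relation names with their arities. -/
structure Schema where
  Rel : Type
  finite_rel : Finite Rel
  arity : Rel → ℕ

/-- A ground atom `R(c₁, …, cₖ)` with constants from `𝒰`. -/
abbrev Fact (S : Schema) (𝒰 : Type) : Type := Σ r : S.Rel, (Fin (S.arity r) → 𝒰)

/-- A database instance: a finite set of ground atoms. -/
abbrev Instance (S : Schema) (𝒰 : Type) : Type := Finset (Fact S 𝒰)

/-- The update operations; `change f A a` gives attribute `A` of the tuple `f` the value `a`. -/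
inductive Update (S : Schema) (𝒰 : Type) : Type
  | insert (f : Fact S 𝒰)
  | delete (f : Fact S 𝒰)
  | change (f : Fact S 𝒰) (A : Fin (S.arity f.1)) (a : 𝒰)

open Classical in
/-- The effect of one update operation. Deleting or changing an absent tuple has no effect. -/
noncomputable def Update.apply {S : Schema} {𝒰 : Type} (D : Instance S 𝒰) :
    Update S 𝒰 → Instance S 𝒰
  | .insert f => Insert.insert f D
  | .delete f => D.erase f
  | .change f A a =>
      if f ∈ D then Insert.insert ⟨f.1, Function.update f.2 A a⟩ (D.erase f) else D

/-- `U(D)`: the operations of the sequence `U` are applied to `D` from left to right. -/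
noncomputable def applyUpdates {S : Schema} {𝒰 : Type}
    (U : List (Update S 𝒰)) (D : Instance S 𝒰) : Instance S 𝒰 :=
  U.foldl Update.apply D

/-! ### The first-order language of a schema -/

/-- The built-in comparison predicates. -/
inductive Comparison : Type
  | eq | ne | lt | le | gt | ge

/-- The meaning of the comparison predicates on a linearly ordered domain. -/
def Comparison.Holds {𝒰 : Type} [LinearOrder 𝒰] : Comparison → 𝒰 → 𝒰 → Prop
  | .eq, a, b => a = b
  | .ne, a, b => a ≠ b
  | .lt, a, b => a < b
  | .le, a, b => a ≤ b
  | .gt, a, b => a > b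
  | .ge, a, b => a ≥ b

/-- Function symbols: a constant symbol for every element of the domain. -/
inductive FunctionSymbol (𝒰 : Type) : ℕ → Type
  | const (c : 𝒰) : FunctionSymbol 𝒰 0

/-- Relation symbols: the relation names of the schema, and the comparison predicates. -/
inductive RelationSymbol (S : Schema) : ℕ → Type
  | db (r : S.Rel) : RelationSymbol S (S.arity r)
  | cmp (c : Comparison) : RelationSymbol S 2

/-- The first-order language determined by the schema `S` over the domain `𝒰`. -/
def lang (S : Schema) (𝒰 : Type) : Language where
  Functions := FunctionSymbol 𝒰
  Relations := RelationSymbol S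

/-- Interpretation of the constant symbols. -/
def constValue {𝒰 : Type} : {n : ℕ} → FunctionSymbol 𝒰 n → (Fin n → 𝒰) → 𝒰
  | _, .const c, _ => c

/-- Interpretation of the relation symbols in an instance. -/
def relHolds {S : Schema} {𝒰 : Type} [LinearOrder 𝒰] (D : Instance S 𝒰) :
    {n : ℕ} → RelationSymbol S n → (Fin n → 𝒰) → Prop
  | _, .db r, t => (⟨r, t⟩ : Fact S 𝒰) ∈ D
  | _, .cmp c, t => c.Holds (t 0) (t 1)

/-- An instance, as a first-order structure with universe `𝒰`. -/
@[reducible] def toStructure {S : Schema} {𝒰 : Type} [LinearOrder 𝒰] (D : Instance S 𝒰) :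
    (lang S 𝒰).Structure 𝒰 where
  funMap := fun f t => constValue f t
  RelMap := fun r t => relHolds D r t

/-! ### Truth of sentences -/

/-- Truth of a formula in an instance when the quantifiers range over the set `E`. -/
def RealizeOn {S : Schema} {𝒰 : Type} [LinearOrder 𝒰] (D : Instance S 𝒰) (E : Set 𝒰) :
    {n : ℕ} → (lang S 𝒰).BoundedFormula Empty n → (Fin n → 𝒰) → Prop
  | _, .falsum, _ => False
  | _, .equal s t, v =>
      letI := toStructure D
      s.realize (Sum.elim Empty.elim v) = t.realize (Sum.elim Empty.elim v)
  | _, .rel R ts, v =>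
      letI := toStructure D
      relHolds D R (fun i => (ts i).realize (Sum.elim Empty.elim v))
  | _, .imp φ ψ, v => RealizeOn D E φ v → RealizeOn D E ψ v
  | n, .all φ, v => ∀ x ∈ E, RealizeOn D E φ (Fin.snoc v x : Fin (n + 1) → 𝒰)

/-- The constants in a function symbol. -/
def symbolConsts {𝒰 : Type} : {n : ℕ} → FunctionSymbol 𝒰 n → Set 𝒰
  | _, .const c => {c}

/-- The constants occurring in a term. -/
def termConsts {S : Schema} {𝒰 α : Type} : (lang S 𝒰).Term α → Set 𝒰
  | .var _ => ∅
  | .func f ts => symbolConsts f ∪ ⋃ i, termConsts (ts i)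

/-- The constants occurring in a formula. -/
def formulaConsts {S : Schema} {𝒰 α : Type} :
    {n : ℕ} → (lang S 𝒰).BoundedFormula α n → Set 𝒰
  | _, .falsum => ∅
  | _, .equal s t => termConsts s ∪ termConsts t
  | _, .rel _ ts => ⋃ i, termConsts (ts i)
  | _, .imp φ ψ => formulaConsts φ ∪ formulaConsts ψ
  | _, .all φ => formulaConsts φ

/-- The active domain of a sentence and an instance: all constants that occur in either. -/
def activeDomain {S : Schema} {𝒰 : Type} (D : Instance S 𝒰) (φ : (lang S 𝒰).Sentence) : Set 𝒰 :=
  {c | ∃ f ∈ D, ∃ i, f.2 i = c} ∪ formulaConsts φ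

/-- Truth under the active-domain semantics: quantifiers range over the active domain. -/
def ActiveTrue {S : Schema} {𝒰 : Type} [LinearOrder 𝒰] (D : Instance S 𝒰)
    (φ : (lang S 𝒰).Sentence) : Prop :=
  RealizeOn D (activeDomain D φ) φ Fin.elim0

/-- Truth under the natural semantics: quantifiers range over the whole domain `𝒰`. -/
def NaturalTrue {S : Schema} {𝒰 : Type} [LinearOrder 𝒰] (D : Instance S 𝒰)
    (φ : (lang S 𝒰).Sentence) : Prop :=
  letI := toStructure D
  φ.Realize 𝒰

/-- A sentence is domain independent if its truth value in an instance is the same for all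
quantifier ranges that contain the active domain. -/
def DomainIndependent {S : Schema} {𝒰 : Type} [LinearOrder 𝒰]
    (φ : (lang S 𝒰).Sentence) : Prop :=
  ∀ (D : Instance S 𝒰) (E₁ E₂ : Set 𝒰), activeDomain D φ ⊆ E₁ → activeDomain D φ ⊆ E₂ →
    (RealizeOn D E₁ φ Fin.elim0 ↔ RealizeOn D E₂ φ Fin.elim0)

/-! ### Denial constraints -/

/-- The data of a denial constraint `∀ x̄ ¬(A₁ ∧ … ∧ Aₖ ∧ γ)`: the number of variables in `x̄`,
the database atoms `Aᵢ`, and the comparison atoms whose conjunction is `γ`. -/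
structure DenialConstraint (S : Schema) (𝒰 : Type) where
  numVars : ℕ
  atoms : List (Σ r : S.Rel, (Fin (S.arity r) → (lang S 𝒰).Term (Empty ⊕ Fin numVars)))
  comparisons : List (Comparison × (lang S 𝒰).Term (Empty ⊕ Fin numVars) ×
    (lang S 𝒰).Term (Empty ⊕ Fin numVars))

/-- The atom `R(t₁, …, tₖ)`. -/
def dbAtom {S : Schema} {𝒰 : Type} {n : ℕ} (r : S.Rel)
    (ts : Fin (S.arity r) → (lang S 𝒰).Term (Empty ⊕ Fin n)) :
    (lang S 𝒰).BoundedFormula Empty n :=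
  Language.BoundedFormula.rel (L := lang S 𝒰) (RelationSymbol.db r) ts

/-- The comparison atom `s c t`. -/
def cmpAtom {S : Schema} {𝒰 : Type} {n : ℕ} (c : Comparison)
    (s t : (lang S 𝒰).Term (Empty ⊕ Fin n)) : (lang S 𝒰).BoundedFormula Empty n :=
  Language.BoundedFormula.rel (L := lang S 𝒰) (RelationSymbol.cmp c) ![s, t]

/-- The sentence `∀ x̄ ¬(A₁ ∧ … ∧ Aₖ ∧ γ)`. -/
def DenialConstraint.toSentence {S : Schema} {𝒰 : Type} (κ : DenialConstraint S 𝒰) :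
    (lang S 𝒰).Sentence :=
  Language.BoundedFormula.alls
    (((κ.atoms.map fun A => dbAtom A.1 A.2) ++
      (κ.comparisons.map fun C => cmpAtom C.1 C.2.1 C.2.2)).foldr (· ⊓ ·) ⊤).not

/-! ### Repairs and consistent answers

`sat` is the truth relation between instances and sentences that is used throughout. -/

/-- `D` satisfies all integrity constraints. -/
def Consistent {S : Schema} {𝒰 : Type} (sat : Instance S 𝒰 → (lang S 𝒰).Sentence → Prop)
    (IC : List (DenialConstraint S 𝒰)) (D : Instance S 𝒰) : Prop :=
  ∀ κ ∈ IC, sat D κ.toSentence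

/-- `D'` is a repair with respect to the preference relation `pref`: it is consistent, and no
consistent instance is strictly preferred to it. -/
def IsRepair {S : Schema} {𝒰 : Type} (sat : Instance S 𝒰 → (lang S 𝒰).Sentence → Prop)
    (IC : List (DenialConstraint S 𝒰)) (pref : Instance S 𝒰 → Instance S 𝒰 → Prop)
    (D' : Instance S 𝒰) : Prop :=
  Consistent sat IC D' ∧
    ¬ ∃ D'' : Instance S 𝒰, Consistent sat IC D'' ∧ pref D'' D' ∧ ¬ pref D' D''

open Classical in
/-- The C-repair preference for the original instance `D`: `|Δ(D', D)| ≤ |Δ(D'', D)|`. -/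
def cardPref {S : Schema} {𝒰 : Type} (D D' D'' : Instance S 𝒰) : Prop :=
  (symmDiff D' D).card ≤ (symmDiff D'' D).card

/-- The C-repairs of `D`. -/
def IsCRepair {S : Schema} {𝒰 : Type} (sat : Instance S 𝒰 → (lang S 𝒰).Sentence → Prop)
    (IC : List (DenialConstraint S 𝒰)) (D D' : Instance S 𝒰) : Prop :=
  IsRepair sat IC (cardPref D) D'

/-- The boolean query `Q` is consistently true in `D` under the C-repair semantics. -/
def CertainlyTrue {S : Schema} {𝒰 : Type} (sat : Instance S 𝒰 → (lang S 𝒰).Sentence → Prop)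
    (IC : List (DenialConstraint S 𝒰)) (Q : (lang S 𝒰).Sentence) (D : Instance S 𝒰) : Prop :=
  ∀ D' : Instance S 𝒰, IsCRepair sat IC D D' → sat D' Q

/-- Inputs of incremental CQA: a list of the tuples of the instance, and an update sequence. -/
abbrev Input (S : Schema) (𝒰 : Type) : Type := List (Fact S 𝒰) × List (Update S 𝒰)

open Classical in
/-- The decision problem of incremental CQA for update sequences of length `m`: the yes-instances
are the `(D, U)` such that `D` is consistent, `U` has length `m`, and `Q` is consistently true
in `U(D)`. -/
def IncrementalCQA {S : Schema} {𝒰 : Type} (sat : Instance S 𝒰 → (lang S 𝒰).Sentence → Prop)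
    (IC : List (DenialConstraint S 𝒰)) (Q : (lang S 𝒰).Sentence) (m : ℕ) (x : Input S 𝒰) : Prop :=
  Consistent sat IC x.1.toFinset ∧ x.2.length = m ∧
    CertainlyTrue sat IC Q (applyUpdates x.2 x.1.toFinset)

/-! ### Encodings and polynomial time -/

open Classical in
/-- A decision problem is in PTIME, with respect to an encoding of its inputs by words over a
finite alphabet, if a Turing machine decides it in a number of steps that is bounded by a
polynomial in the length of the encoded input. -/
def InPTIME {α Γ : Type} (encode : α → List Γ) (p : α → Prop) : Prop :=
  Nonempty (Turing.TM2ComputableInPolyTime encode Computability.encodeBool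
    (fun a => decide (p a)))

/-- A pair of constants as a word: the two codes, separated by `none`. -/
def encodePair {𝒰 : Type} (enc : 𝒰 → List Bool) (p : 𝒰 × 𝒰) : List (Option Bool) :=
  (enc p.1).map some ++ none :: (enc p.2).map some

/-- The alphabet for the inputs of incremental CQA over the schema `S`. -/
inductive Letter (S : Schema) : Type
  | bit (b : Bool)
  | sep
  | fact (r : S.Rel)
  | insert (r : S.Rel)
  | delete (r : S.Rel)
  | change (r : S.Rel) (A : Fin (S.arity r))

/-- A constant as a word, closed by a separator. -/
def encodeConst (S : Schema) {𝒰 : Type} (enc : 𝒰 → List Bool) (c : 𝒰) : List (Letter S) :=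
  (enc c).map Letter.bit ++ [Letter.sep]

/-- A tuple of constants as a word. -/
def encodeTuple (S : Schema) {𝒰 : Type} (enc : 𝒰 → List Bool) {k : ℕ} (t : Fin k → 𝒰) :
    List (Letter S) :=
  (List.ofFn t).flatMap (encodeConst S enc)

/-- A ground atom as a word. -/
def encodeFact {S : Schema} {𝒰 : Type} (enc : 𝒰 → List Bool) (f : Fact S 𝒰) : List (Letter S) :=
  Letter.fact f.1 :: encodeTuple S enc f.2

/-- An update operation as a word. -/
def encodeUpdate {S : Schema} {𝒰 : Type} (enc : 𝒰 → List Bool) : Update S 𝒰 → List (Letter S)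
  | .insert f => Letter.insert f.1 :: encodeTuple S enc f.2
  | .delete f => Letter.delete f.1 :: encodeTuple S enc f.2
  | .change f A a => Letter.change f.1 A :: (encodeTuple S enc f.2 ++ encodeConst S enc a)

/-- An input of incremental CQA as a word: the tuples of the instance, then the updates. -/
def encodeInput {S : Schema} {𝒰 : Type} (enc : 𝒰 → List Bool) (x : Input S 𝒰) :
    List (Letter S) :=
  x.1.flatMap (encodeFact enc) ++ x.2.flatMap (encodeUpdate enc)

end IncCQA

/-! The combinatorial reason. Denial constraints survive the passage to a sub-instance: a violation
in `D' ⊆ D` uses atoms and constants that are also present in `D` (`Consistent.anti`). Let `D` be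
consistent, and let `U` have length `m`. Each operation adds at most one fact, so `U(D) \ D` has at
most `m` elements (`card_applyUpdates_sdiff`), and deleting them from `U(D)` leaves a subset of `D`,
which is consistent. Hence every C-repair of `U(D)` has distance at most `m`. A C-repair `D'` is
moreover a subset of `U(D)`, since `D' ∩ U(D)` is consistent too and strictly closer unless they
coincide. So the C-repairs are the consistent instances `U(D) \ T` with `|T|` minimal, and `|T| ≤
m`. The answer is yes iff for each `k ≤ m` either fewer than `k` deletions already restore
consistency, or no `k` deletions lead to a consistent instance that falsifies `Q`
(`forall_minimal_iff`, `incrementalCQA_iff`). For fixed `m` there are polynomially many sets `T`,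
and a fixed sentence is evaluated in polynomial time by loops over the active domain. Domain
independence reduces the natural semantics to the active-domain semantics.

The computational side. The algorithm has to become a multi-stack Turing machine. Program fragments
are closed under sequence, conditional and loop. On top of them, `PolyTrans` describes fragments
that transform a stack of words in polynomial time, `PolyFun` those that push one computed word,
`PolyPred` those that push a truth value. Everything is then assembled from these closure
properties. The essential one is `PolyTrans.fold`: a loop over a coded list is polynomial if its
body is and if the accumulator stays polynomially bounded. The hypothesis on `<` enters by running
the given machine as a subroutine on stacks of its own (`PolyTrans.embedded`). `inPTIME_of_polyFun`
turns the final program into a machine that meets the input and output conventions. -/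

namespace IncCQA

open Turing FirstOrder

section

/-! ### Program fragments for stack machines -/

section Fragments

variable {K : Type} {Γ : K → Type} {σ Λ Λ' : Type}

/-- `Steps m n c c'`: the program `m` leads from `c` to `c'` in exactly `n` steps. -/
inductive Steps [DecidableEq K] (m : Λ → TM2.Stmt Γ Λ σ) :
    ℕ → TM2.Cfg Γ Λ σ → TM2.Cfg Γ Λ σ → Prop
  | refl (c) : Steps m 0 c c
  | head {n l v S c} : Steps m n (TM2.stepAux (m l) v S) c → Steps m (n + 1) ⟨some l, v, S⟩ c

/-- Relabel the jump targets by `f`; halting becomes a jump to `e`, if there is one. -/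
def relabel (f : Λ → Λ') (e : Option Λ') : TM2.Stmt Γ Λ σ → TM2.Stmt Γ Λ' σ
  | .push k g q => .push k g (relabel f e q)
  | .peek k g q => .peek k g (relabel f e q)
  | .pop k g q => .pop k g (relabel f e q)
  | .load g q => .load g (relabel f e q)
  | .branch g q₁ q₂ => .branch g (relabel f e q₁) (relabel f e q₂)
  | .goto g => .goto fun v => f (g v)
  | .halt => match e with
    | none => .halt
    | some l => .goto fun _ => l

/-- The effect of `relabel` on configurations. -/
def relabelCfg (f : Λ → Λ') (e : Option Λ') (c : TM2.Cfg Γ Λ σ) : TM2.Cfg Γ Λ' σ :=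
  ⟨match c.l with
    | none => e
    | some l => some (f l), c.var, c.stk⟩

/-- A program with an entry point; halting is its exit. -/
structure Frag (Γ : K → Type) (σ : Type) where
  Λ : Type
  fin : Fintype Λ
  entry : Λ
  m : Λ → TM2.Stmt Γ Λ σ

/-- A test: it may change the state only, and yields a truth value. -/
structure Test (Γ : K → Type) (σ : Type) where
  pre : ∀ {Λ : Type}, TM2.Stmt Γ Λ σ → TM2.Stmt Γ Λ σ
  cond : σ → Bool

variable [DecidableEq K]

theorem Steps.trans {m : Λ → TM2.Stmt Γ Λ σ} {n n' : ℕ} {a b c : TM2.Cfg Γ Λ σ}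
    (h : Steps m n a b) (h' : Steps m n' b c) : Steps m (n + n') a c := by
  induction h with
  | refl => simpa using h'
  | head _ ih =>
    rw [Nat.add_right_comm]
    exact .head (ih h')

theorem stepAux_relabel (f : Λ → Λ') (e : Option Λ') (q : TM2.Stmt Γ Λ σ) (v : σ)
    (S : ∀ k, List (Γ k)) :
    TM2.stepAux (relabel f e q) v S = relabelCfg f e (TM2.stepAux q v S) := by
  induction q generalizing v S with
  | push k g q ih => simp [relabel, ih]
  | peek k g q ih => simp [relabel, ih]
  | pop k g q ih => simp [relabel, ih]
  | load g q ih => simp [relabel, ih]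
  | branch g q₁ q₂ ih₁ ih₂ => cases h : g v <;> simp [relabel, h, ih₁, ih₂]
  | goto g => simp [relabel, relabelCfg]
  | halt => cases e <;> simp [relabel, relabelCfg]

theorem Steps.relabel {m : Λ → TM2.Stmt Γ Λ σ} {m' : Λ' → TM2.Stmt Γ Λ' σ} {f : Λ → Λ'}
    {e : Option Λ'} (hm : ∀ l, m' (f l) = IncCQA.relabel f e (m l)) {n : ℕ}
    {c c' : TM2.Cfg Γ Λ σ} (h : Steps m n c c') :
    Steps m' n (relabelCfg f e c) (relabelCfg f e c') := by
  induction h with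
  | refl => exact .refl _
  | @head n l v S c _ ih =>
    refine .head (l := f l) ?_
    rwa [hm, stepAux_relabel]

/-- A halted configuration has no successor, so an iteration that still yields a configuration has
taken a genuine step each time. -/
theorem steps_of_iterate {m : Λ → TM2.Stmt Γ Λ σ} {n : ℕ} {c c' : TM2.Cfg Γ Λ σ}
    (h : (flip bind (TM2.step m))^[n] (some c) = some c') : Steps m n c c' := by
  induction n generalizing c with
  | zero =>
    obtain rfl : c = c' := by simpa using h
    exact .refl _
  | succ n ih =>
    rw [Function.iterate_succ_apply] at h
    obtain ⟨l, v, S⟩ := c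
    cases l with
    | none =>
      exfalso
      have : ∀ n, (flip bind (TM2.step m))^[n] none = none := fun n =>
        Function.iterate_fixed rfl n
      have h2 : flip bind (TM2.step m) (some ⟨none, v, S⟩) = none := rfl
      rw [h2, this] at h
      cases h
    | some l => exact .head (ih h)

theorem Steps.iterate {m : Λ → TM2.Stmt Γ Λ σ} {n : ℕ} {c c' : TM2.Cfg Γ Λ σ}
    (h : Steps m n c c') : (flip bind (TM2.step m))^[n] (some c) = some c' := by
  induction h with
  | refl => rfl
  | head _ ih => rwa [Function.iterate_succ_apply]

/-- From the stacks `S` the fragment `M` reaches its exit with stacks `S'` within `t` steps,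
whatever the internal state is at the start. -/
def Frag.Sends (M : Frag Γ σ) (t : ℕ) (S S' : ∀ k, List (Γ k)) : Prop :=
  ∀ v, ∃ v', ∃ n ≤ t, Steps M.m n ⟨some M.entry, v, S⟩ ⟨none, v', S'⟩

theorem Frag.Sends.mono {M : Frag Γ σ} {t t' : ℕ} {S S' : ∀ k, List (Γ k)}
    (h : M.Sends t S S') (ht : t ≤ t') : M.Sends t' S S' := fun v =>
  let ⟨v', n, hn, hs⟩ := h v
  ⟨v', n, hn.trans ht, hs⟩

/-- A fragment consisting of one statement. -/
def Frag.basic (q : TM2.Stmt Γ Unit σ) : Frag Γ σ := ⟨Unit, inferInstance, (), fun _ => q⟩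

theorem Frag.basic_sends {q : TM2.Stmt Γ Unit σ} {S S' : ∀ k, List (Γ k)}
    (h : ∀ v, ∃ v', TM2.stepAux q v S = ⟨none, v', S'⟩) : (Frag.basic q).Sends 1 S S' := fun v =>
  let ⟨v', hv⟩ := h v
  ⟨v', 1, le_rfl, .head (by simpa only [hv, Frag.basic] using Steps.refl _)⟩

/-- Sequential composition. -/
def Frag.seq (M N : Frag Γ σ) : Frag Γ σ where
  Λ := M.Λ ⊕ N.Λ
  fin := letI := M.fin; letI := N.fin; inferInstance
  entry := .inl M.entry
  m := Sum.elim (fun l => relabel .inl (some (.inr N.entry)) (M.m l))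
    (fun l => relabel .inr none (N.m l))

theorem Frag.seq_sends {M N : Frag Γ σ} {t t' : ℕ} {S S' S'' : ∀ k, List (Γ k)}
    (h : M.Sends t S S') (h' : N.Sends t' S' S'') : (M.seq N).Sends (t + t') S S'' := fun v =>
  let ⟨v', _, hn, hs⟩ := h v
  let ⟨v'', _, hn', hs'⟩ := h' v'
  ⟨v'', _, add_le_add hn hn',
    (hs.relabel (m' := (M.seq N).m) (f := .inl) (e := some (.inr N.entry)) fun _ => rfl).trans
      (hs'.relabel (m' := (M.seq N).m) (f := .inr) (e := none) fun _ => rfl)⟩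

/-- On the stacks `S` the test `T` yields `b`. -/
def Test.Decides (T : Test Γ σ) (S : ∀ k, List (Γ k)) (b : Bool) : Prop :=
  ∀ v, ∃ v', T.cond v' = b ∧
    ∀ (Λ : Type) (q : TM2.Stmt Γ Λ σ), TM2.stepAux (T.pre q) v S = TM2.stepAux q v' S

/-- Conditional. -/
def Frag.ite (T : Test Γ σ) (M N : Frag Γ σ) : Frag Γ σ where
  Λ := Option (M.Λ ⊕ N.Λ)
  fin := letI := M.fin; letI := N.fin; inferInstance
  entry := none
  m
    | none => T.pre (.branch T.cond (.goto fun _ => some (.inl M.entry))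
        (.goto fun _ => some (.inr N.entry)))
    | some (.inl l) => relabel (fun l => some (.inl l)) none (M.m l)
    | some (.inr l) => relabel (fun l => some (.inr l)) none (N.m l)

theorem Frag.ite_sends_true {T : Test Γ σ} {M N : Frag Γ σ} {t : ℕ} {S S' : ∀ k, List (Γ k)}
    (hT : T.Decides S true) (h : M.Sends t S S') : (Frag.ite T M N).Sends (t + 1) S S' := by
  intro v
  obtain ⟨v₁, hc, hq⟩ := hT v
  obtain ⟨v', n, hn, hs⟩ := h v₁
  refine ⟨v', n + 1, by omega, .head ?_⟩
  have := hs.relabel (m' := (Frag.ite T M N).m) (f := fun l => some (.inl l)) (e := none)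
    fun _ => rfl
  simpa [Frag.ite, hq, hc, relabelCfg] using this

theorem Frag.ite_sends_false {T : Test Γ σ} {M N : Frag Γ σ} {t : ℕ} {S S' : ∀ k, List (Γ k)}
    (hT : T.Decides S false) (h : N.Sends t S S') : (Frag.ite T M N).Sends (t + 1) S S' := by
  intro v
  obtain ⟨v₁, hc, hq⟩ := hT v
  obtain ⟨v', n, hn, hs⟩ := h v₁
  refine ⟨v', n + 1, by omega, .head ?_⟩
  have := hs.relabel (m' := (Frag.ite T M N).m) (f := fun l => some (.inr l)) (e := none)
    fun _ => rfl
  simpa [Frag.ite, hq, hc, relabelCfg] using this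

/-- Loop: as long as the test succeeds, `M` is executed. -/
def Frag.loop (T : Test Γ σ) (M : Frag Γ σ) : Frag Γ σ where
  Λ := Option M.Λ
  fin := letI := M.fin; inferInstance
  entry := none
  m
    | none => T.pre (.branch T.cond (.goto fun _ => some M.entry) .halt)
    | some l => relabel some (some none) (M.m l)

theorem Frag.loop_exit {T : Test Γ σ} (M : Frag Γ σ) {S : ∀ k, List (Γ k)}
    (hT : T.Decides S false) : (Frag.loop T M).Sends 1 S S := by
  intro v
  obtain ⟨v₁, hc, hq⟩ := hT v
  refine ⟨v₁, 1, le_rfl, .head ?_⟩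
  simpa [Frag.loop, hq, hc] using Steps.refl _

/-- Halting of the body is relabelled to a jump to the test, so one round is followed by a run of
the whole loop. The internal state left by the body is unknown, which is why `Sends` and `Decides`
quantify over all states. -/
theorem Frag.loop_step {T : Test Γ σ} {M : Frag Γ σ} {t t' : ℕ} {S S' S'' : ∀ k, List (Γ k)}
    (hT : T.Decides S true) (h : M.Sends t S S') (h' : (Frag.loop T M).Sends t' S' S'') :
    (Frag.loop T M).Sends (t' + t + 1) S S'' := by
  intro v
  obtain ⟨v₁, hc, hq⟩ := hT v
  obtain ⟨v₂, n, hn, hs⟩ := h v₁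
  obtain ⟨v₃, n', hn', hs'⟩ := h' v₂
  refine ⟨v₃, (n + n') + 1, by omega, .head ?_⟩
  have := (hs.relabel (m' := (Frag.loop T M).m) (f := some) (e := some none)
    fun _ => rfl).trans hs'
  simpa [Frag.loop, hq, hc, relabelCfg] using this

end Fragments

end

section

/-! ### A machine with four registers, an input, an output and the stacks of another machine -/

/-- The work bank: a stack of cells, a second one, and two scratch bank for single cells. -/
inductive Reg : Type
  | env | frame | one | two

/-- The stacks of the machine; `κ` indexes the stacks of the embedded machine. -/
inductive Tape (κ : Type) : Type
  | input
  | output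
  | reg (r : Reg)
  | ext (k : κ)

noncomputable instance : DecidableEq Reg := Classical.decEq _

noncomputable instance (κ : Type) : DecidableEq (Tape κ) := Classical.decEq _

instance : Finite Reg :=
  Finite.of_surjective (fun n : Fin 4 => ![Reg.env, .frame, .one, .two] n) fun r => by
    cases r
    exacts [⟨0, rfl⟩, ⟨1, rfl⟩, ⟨2, rfl⟩, ⟨3, rfl⟩]

instance (κ : Type) [Finite κ] : Finite (Tape κ) :=
  Finite.of_surjective (fun x : (Bool ⊕ Reg) ⊕ κ => match x with
    | .inl (.inl false) => .input
    | .inl (.inl true) => .output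
    | .inl (.inr r) => .reg r
    | .inr k => .ext k) fun t => by
      cases t
      exacts [⟨.inl (.inl false), rfl⟩, ⟨.inl (.inl true), rfl⟩, ⟨.inl (.inr _), rfl⟩,
        ⟨.inr _, rfl⟩]

variable {A : Type} {tm : FinTM2}

/-- The stack alphabets; in the registers, `none` closes a cell. -/
@[reducible] def Alph (A : Type) (tm : FinTM2) : Tape tm.K → Type
  | .input => A
  | .output => Bool
  | .reg _ => Option A
  | .ext k => tm.Γ k

/-- The internal states: two register symbols that were read, and a state of the embedded
machine. -/
abbrev IState (A : Type) (tm : FinTM2) : Type :=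
  (Option (Option A) × Option (Option A)) × tm.σ

/-- All stacks, given by groups. -/
def bank (i : List A) (o : List Bool) (ρ : Reg → List (Option A)) (L : ∀ k, List (tm.Γ k)) :
    ∀ k, List (Alph A tm k)
  | .input => i
  | .output => o
  | .reg r => ρ r
  | .ext k => L k

/-- The contents of the registers. -/
def regs (e f a b : List (Option A)) : Reg → List (Option A)
  | .env => e
  | .frame => f
  | .one => a
  | .two => b

section Updates

variable (i : List A) (o : List Bool) (ρ : Reg → List (Option A)) (L : ∀ k, List (tm.Γ k))

@[simp] theorem bank_input : bank i o ρ L .input = i := rfl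
@[simp] theorem bank_output : bank i o ρ L .output = o := rfl
@[simp] theorem bank_reg (r : Reg) : bank i o ρ L (.reg r) = ρ r := rfl
@[simp] theorem bank_ext (k : tm.K) : bank i o ρ L (.ext k) = L k := rfl

@[simp] theorem update_bank_input (x : List A) :
    Function.update (bank i o ρ L) .input x = bank x o ρ L := by
  funext k; cases k <;> simp [Function.update, bank]

@[simp] theorem update_bank_output (x : List Bool) :
    Function.update (bank i o ρ L) .output x = bank i x ρ L := by
  funext k; cases k <;> simp [Function.update, bank]

@[simp] theorem update_bank_reg (r : Reg) (x : List (Option A)) :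
    Function.update (bank i o ρ L) (.reg r) x = bank i o (Function.update ρ r x) L := by
  funext k
  cases k with
  | reg s =>
    by_cases h : s = r
    · subst h; simp [bank]
    · simp [bank, h]
  | _ => simp [bank, Function.update]

@[simp] theorem update_bank_ext (k : tm.K) (x : List (tm.Γ k)) :
    Function.update (bank i o ρ L) (.ext k) x = bank i o ρ (Function.update L k x) := by
  funext k'
  cases k' with
  | ext s =>
    by_cases h : s = k
    · subst h; simp [bank]
    · simp [bank, h]
  | _ => simp [bank, Function.update]

variable (e f a b x : List (Option A))

@[simp] theorem regs_env : regs e f a b .env = e := rfl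
@[simp] theorem regs_frame : regs e f a b .frame = f := rfl
@[simp] theorem regs_one : regs e f a b .one = a := rfl
@[simp] theorem regs_two : regs e f a b .two = b := rfl

@[simp] theorem update_regs_env : Function.update (regs e f a b) .env x = regs x f a b := by
  funext r; cases r <;> simp [Function.update, regs]
@[simp] theorem update_regs_frame : Function.update (regs e f a b) .frame x = regs e x a b := by
  funext r; cases r <;> simp [Function.update, regs]
@[simp] theorem update_regs_one : Function.update (regs e f a b) .one x = regs e f x b := by
  funext r; cases r <;> simp [Function.update, regs]
@[simp] theorem update_regs_two : Function.update (regs e f a b) .two x = regs e f a x := by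
  funext r; cases r <;> simp [Function.update, regs]

end Updates

/-- Read the top symbols of two registers, and test them. -/
def topTest (tm : FinTM2) (X Y : Reg) (P : Option (Option A) → Option (Option A) → Bool) :
    Test (Alph A tm) (IState A tm) where
  pre q := .peek (.reg X) (fun v c => ((c, v.1.2), v.2))
    (.peek (.reg Y) (fun v c => ((v.1.1, c), v.2)) q)
  cond v := P v.1.1 v.1.2

theorem topTest_decides (X Y : Reg) (P : Option (Option A) → Option (Option A) → Bool)
    {S : ∀ k, List (Alph A tm k)} {b : Bool} (h : P (S (.reg X)).head? (S (.reg Y)).head? = b) :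
    (topTest tm X Y P).Decides S b := fun v =>
  ⟨(((S (.reg X)).head?, (S (.reg Y)).head?), v.2), h, fun Λ q => by simp [topTest]⟩

/-- Pop a register, and push the symbol onto the registers `Ys`. -/
def popPush (tm : FinTM2) (X : Reg) (Ys : List Reg) : Frag (Alph A tm) (IState A tm) :=
  .basic (.pop (.reg X) (fun v c => ((c, v.1.2), v.2))
    (Ys.foldr (fun Y q => .push (.reg Y) (fun v => v.1.1.getD none) q) .halt))

/-- Push symbols onto a register. -/
def pushAll (tm : FinTM2) (X : Reg) (w : List (Option A)) : Frag (Alph A tm) (IState A tm) :=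
  .basic (w.foldr (fun c q => .push (.reg X) (fun _ => c) q) .halt)

theorem popPush_sends (X : Reg) (Ys : List Reg) {i : List A} {o : List Bool}
    {ρ : Reg → List (Option A)} {L : ∀ k, List (tm.Γ k)} {c : Option A} {w : List (Option A)}
    (h : ρ X = c :: w) :
    (popPush tm X Ys).Sends 1 (bank i o ρ L)
      (bank i o (Ys.foldl (fun ρ Y => Function.update ρ Y (c :: ρ Y))
        (Function.update ρ X w)) L) := by
  refine Frag.basic_sends fun v => ⟨((some c, v.1.2), v.2), ?_⟩
  simp only [TM2.stepAux, bank_reg, h, List.head?_cons, List.tail_cons, update_bank_reg]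
  generalize Function.update ρ X w = ρ'
  induction Ys generalizing ρ' with
  | nil => simp
  | cons Y Ys ih => simp [ih]

theorem pushAll_sends (X : Reg) (w : List (Option A)) {i : List A} {o : List Bool}
    {ρ : Reg → List (Option A)} {L : ∀ k, List (tm.Γ k)} :
    (pushAll tm X w).Sends 1 (bank i o ρ L)
      (bank i o (Function.update ρ X (w.reverse ++ ρ X)) L) := by
  refine Frag.basic_sends fun v => ⟨v, ?_⟩
  induction w generalizing ρ with
  | nil => simp
  | cons c w ih => simp [ih]

/-- The symbol is a letter, not the end of a cell or of the stack. -/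
def isLetter (c : Option (Option A)) : Bool := c.join.isSome

/-- Pop the letters of a cell, and push them onto the registers `Ys`. -/
def scanLetters (tm : FinTM2) (X : Reg) (Ys : List Reg) : Frag (Alph A tm) (IState A tm) :=
  .loop (topTest tm X X fun c _ => isLetter c) (popPush tm X Ys)

/-- `F w u` describes the registers when `w` is still to be read and `u` has been read, latest
letter first; `hF` says that one round keeps this form. Dropping, moving and copying a cell are the
cases of no, one and two targets. The condition on `tail` makes the scan stop at the end of the
cell. -/
theorem scanLetters_sends (X : Reg) (Ys : List Reg) {i : List A} {o : List Bool}
    {L : ∀ k, List (tm.Γ k)} (tail : List (Option A)) (ht : isLetter tail.head? = false)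
    (F : List A → List A → Reg → List (Option A))
    (hX : ∀ w u, F w u X = w.map some ++ tail)
    (hF : ∀ c w u, Ys.foldl (fun ρ Y => Function.update ρ Y (some c :: ρ Y))
      (Function.update (F (c :: w) u) X (w.map some ++ tail)) = F w (c :: u)) (w u : List A) :
    (scanLetters tm X Ys).Sends (2 * w.length + 1) (bank i o (F w u) L)
      (bank i o (F [] (w.reverse ++ u)) L) := by
  induction w generalizing u with
  | nil => exact Frag.loop_exit _ (topTest_decides _ _ _ (by simpa [hX] using ht))
  | cons c w ih =>
    have h := popPush_sends (tm := tm) X Ys (i := i) (o := o) (L := L)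
      (w := w.map some ++ tail) (hX (c :: w) u)
    rw [hF] at h
    have := Frag.loop_step (T := topTest tm X X fun c _ => isLetter c)
      (topTest_decides _ _ _ (by simp [hX, isLetter])) h (ih (c :: u))
    simpa [scanLetters] using this.mono (t' := 2 * (c :: w).length + 1) (by simp; omega)

section Scan

variable {i : List A} {o : List Bool} {ρ : Reg → List (Option A)} {L : ∀ k, List (tm.Γ k)}
  {X Y Z : Reg} {w : List A} {tail : List (Option A)}

theorem scan_drop (ht : isLetter tail.head? = false) (hX : ρ X = w.map some ++ tail) :
    (scanLetters tm X []).Sends (2 * w.length + 1) (bank i o ρ L)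
      (bank i o (Function.update ρ X tail) L) := by
  have := scanLetters_sends (tm := tm) (i := i) (o := o) (L := L) X [] tail ht
    (fun w _ => Function.update ρ X (w.map some ++ tail)) (by simp) (by simp) w []
  simpa [← hX] using this

theorem scan_move (hXY : X ≠ Y) (ht : isLetter tail.head? = false)
    (hX : ρ X = w.map some ++ tail) :
    (scanLetters tm X [Y]).Sends (2 * w.length + 1) (bank i o ρ L)
      (bank i o (Function.update (Function.update ρ X tail) Y (w.reverse.map some ++ ρ Y)) L) := by
  have := scanLetters_sends (tm := tm) (i := i) (o := o) (L := L) X [Y] tail ht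
    (fun w u => Function.update (Function.update ρ X (w.map some ++ tail)) Y
      (u.map some ++ ρ Y)) (by simp [hXY]) ?_ w []
  · simpa [← hX] using this
  · intro c w u
    funext r
    by_cases h1 : r = Y
    · subst h1; simp [hXY.symm]
    · by_cases h2 : r = X
      · subst h2; simp [h1]
      · simp [h1, h2]

theorem scan_copy (hXY : X ≠ Y) (hXZ : X ≠ Z) (hYZ : Y ≠ Z) (ht : isLetter tail.head? = false)
    (hX : ρ X = w.map some ++ tail) :
    (scanLetters tm X [Y, Z]).Sends (2 * w.length + 1) (bank i o ρ L)
      (bank i o (Function.update (Function.update (Function.update ρ X tail) Y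
        (w.reverse.map some ++ ρ Y)) Z (w.reverse.map some ++ ρ Z)) L) := by
  have := scanLetters_sends (tm := tm) (i := i) (o := o) (L := L) X [Y, Z] tail ht
    (fun w u => Function.update (Function.update (Function.update ρ X (w.map some ++ tail)) Y
      (u.map some ++ ρ Y)) Z (u.map some ++ ρ Z)) (by simp [hXY, hXZ]) ?_ w []
  · simpa [← hX] using this
  · intro c w u
    funext r
    by_cases h1 : r = Z
    · subst h1; simp [hXZ.symm, hYZ.symm]
    · by_cases h2 : r = Y
      · subst h2; simp [h1, hXY.symm]
      · by_cases h3 : r = X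
        · subst h3; simp [h1, h2]
        · simp [h1, h2, h3]

/-- Move the top cell of `X` onto the empty register `Y`, in reversed order. -/
def takeCell (tm : FinTM2) (X Y : Reg) : Frag (Alph A tm) (IState A tm) :=
  (scanLetters tm X [Y]).seq (popPush tm X [])

/-- Make the contents of `Y`, in reversed order, the top cell of `X`. -/
def putCell (tm : FinTM2) (Y X : Reg) : Frag (Alph A tm) (IState A tm) :=
  (pushAll tm X [none]).seq (scanLetters tm Y [X])

theorem takeCell_sends (hXY : X ≠ Y) {rest : List (Option A)}
    (hX : ρ X = w.map some ++ none :: rest) (hY : ρ Y = []) :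
    (takeCell tm X Y).Sends (2 * w.length + 2) (bank i o ρ L)
      (bank i o (Function.update (Function.update ρ X rest) Y (w.reverse.map some)) L) := by
  have h1 := scan_move (tm := tm) (i := i) (o := o) (L := L) hXY (by rfl) hX
  have h2 := popPush_sends (tm := tm) (i := i) (o := o) (L := L) X [] (w := rest) (c := none)
    (ρ := Function.update (Function.update ρ X (none :: rest)) Y (w.reverse.map some ++ ρ Y))
    (by simp [hXY])
  unfold takeCell
  convert Frag.seq_sends h1 h2 using 2
  rw [List.foldl_nil, hY, List.append_nil]
  funext r
  by_cases h1 : r = X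
  · subst h1; simp [hXY]
  · simp [Function.update, h1]

theorem putCell_sends (hXY : Y ≠ X) (hY : ρ Y = w.map some) :
    (putCell tm Y X).Sends (2 * w.length + 2) (bank i o ρ L)
      (bank i o (Function.update (Function.update ρ Y []) X
        (w.reverse.map some ++ none :: ρ X)) L) := by
  have h1 := pushAll_sends (tm := tm) X [none] (i := i) (o := o) (L := L) (ρ := ρ)
  have h2 := scan_move (tm := tm) (i := i) (o := o) (L := L) (w := w) (tail := []) hXY (by rfl)
    (ρ := Function.update ρ X ([none].reverse ++ ρ X)) (by simp [hXY, hY])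
  unfold putCell
  convert (Frag.seq_sends h1 h2).mono (t' := 2 * w.length + 2) (by omega) using 2
  rw [Function.update_comm hXY.symm, Function.update_idem]
  simp

end Scan

end

section

variable {A : Type} {tm : FinTM2}

/-! ### Polynomial-time transformations of stacks of words -/

/-- A stack of words, as the contents of a register. -/
def cells (e : List (List A)) : List (Option A) := e.flatMap fun w => w.map some ++ [none]

@[simp] theorem cells_nil : cells ([] : List (List A)) = [] := rfl

@[simp] theorem cells_cons (w : List A) (e : List (List A)) :
    cells (w :: e) = w.map some ++ none :: cells e := by simp [cells]

/-- The space taken by a stack of words. -/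
def size (e : List (List A)) : ℕ := (cells e).length

@[simp] theorem size_nil : size ([] : List (List A)) = 0 := rfl

@[simp] theorem size_cons (w : List A) (e : List (List A)) :
    size (w :: e) = w.length + 1 + size e := by
  simp [size]; omega

/-- The configuration of the stacks between two operations. -/
def base (tm : FinTM2) (e f : List (List A)) : ∀ k, List (Alph A tm k) :=
  bank [] [] (regs (cells e) (cells f) [] []) fun _ => []

theorem eval_mono (p : Polynomial ℕ) : Monotone fun n => p.eval n := fun m n h => by
  induction p using Polynomial.induction_on' with
  | add p q hp hq => simpa using add_le_add hp hq
  | monomial k c => simpa using Nat.mul_le_mul_left c (Nat.pow_le_pow_left h k)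

variable {α β γ : Type}

/-- A fragment transforms the stack `g a` into the stack `h a`, for all `a`, in polynomial time and
without looking at the second stack. -/
def PolyTrans (tm : FinTM2) (g h : α → List (List A)) : Prop :=
  ∃ (M : Frag (Alph A tm) (IState A tm)) (p : Polynomial ℕ), ∀ a,
    size (h a) ≤ p.eval (size (g a)) ∧
      ∀ f, M.Sends (p.eval (size (g a))) (base tm (g a) f) (base tm (h a) f)

variable {g h k : α → List (List A)}

/-- The size bound in `PolyTrans` is there for this: the second program starts from a stack of size
at most `p`, and polynomials over `ℕ` are monotone, so it costs at most `q ∘ p`. -/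
theorem PolyTrans.trans (h₁ : PolyTrans tm g h) (h₂ : PolyTrans tm h k) : PolyTrans tm g k := by
  obtain ⟨M, p, hM⟩ := h₁
  obtain ⟨N, q, hN⟩ := h₂
  refine ⟨M.seq N, p + q.comp p, fun a => ?_⟩
  have hle := eval_mono q (hM a).1
  simp only [Polynomial.eval_add, Polynomial.eval_comp]
  refine ⟨?_, fun f => (Frag.seq_sends ((hM a).2 f) ((hN a).2 f)).mono ?_⟩
  · have := (hN a).1
    simp only at hle
    omega
  · simp only at hle
    omega

theorem PolyTrans.comap (H : PolyTrans tm g h) (i : β → α) :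
    PolyTrans tm (fun b => g (i b)) (fun b => h (i b)) :=
  let ⟨M, p, hM⟩ := H
  ⟨M, p, fun b => hM (i b)⟩

theorem PolyTrans.of_linear (M : Frag (Alph A tm) (IState A tm)) (c d : ℕ)
    (hs : ∀ a, size (h a) ≤ c * size (g a) + d)
    (hM : ∀ a f, M.Sends (c * size (g a) + d) (base tm (g a) f) (base tm (h a) f)) :
    PolyTrans tm g h :=
  ⟨M, .C c * .X + .C d, fun a => by simpa using ⟨hs a, hM a⟩⟩

/-- The Boolean values as words. -/
def boolWord (l : A) (b : Bool) : List A := if b then [l] else []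

section Primitives

variable (x y : α → List A) (g : α → List (List A))

theorem PolyTrans.drop : PolyTrans tm (fun a => x a :: g a) g :=
  .of_linear ((scanLetters tm .env []).seq (popPush tm .env [])) 2 2
    (fun a => by simp; omega) fun a f => by
    have h1 := scan_drop (tm := tm) (X := .env) (w := x a) (tail := none :: cells (g a)) (i := [])
      (o := []) (ρ := regs (cells (x a :: g a)) (cells f) [] []) (L := fun _ => []) rfl (by simp)
    have h2 := popPush_sends (tm := tm) (i := []) (o := []) (L := fun _ => []) .env []
      (w := cells (g a)) (c := none) (ρ := regs (none :: cells (g a)) (cells f) [] []) rfl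
    simp only [update_regs_env] at h1 h2
    refine (Frag.seq_sends h1 h2).mono ?_
    simp; omega

theorem PolyTrans.push (w : List A) : PolyTrans tm g (fun a => w :: g a) :=
  .of_linear (pushAll tm .env (w.map some ++ [none]).reverse) 1 (w.length + 1)
    (fun a => by simp; omega) fun a f => by
    have := pushAll_sends (tm := tm) (i := []) (o := []) (L := fun _ => []) .env
      (w.map some ++ [none]).reverse (ρ := regs (cells (g a)) (cells f) [] [])
    simp only [List.reverse_reverse, regs_env, update_regs_env] at this
    simpa [base] using this.mono (t' := 1 * size (g a) + (w.length + 1)) (by omega)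

theorem takeCell_one (w : List A) (e f : List (List A)) (b : List (Option A)) :
    (takeCell tm .env .one).Sends (2 * w.length + 2)
      (bank [] [] (regs (cells (w :: e)) (cells f) [] b) fun _ => [])
      (bank [] [] (regs (cells e) (cells f) (w.reverse.map some) b) fun _ => []) := by
  simpa using takeCell_sends (tm := tm) (i := []) (o := []) (L := fun _ => []) (X := .env)
    (Y := .one) (by simp) (w := w) (rest := cells e) (ρ := regs (cells (w :: e)) (cells f) [] b)
    (by simp) rfl

theorem takeCell_two (w : List A) (e f : List (List A)) (b : List (Option A)) :
    (takeCell tm .env .two).Sends (2 * w.length + 2)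
      (bank [] [] (regs (cells (w :: e)) (cells f) b []) fun _ => [])
      (bank [] [] (regs (cells e) (cells f) b (w.reverse.map some)) fun _ => []) := by
  simpa using takeCell_sends (tm := tm) (i := []) (o := []) (L := fun _ => []) (X := .env)
    (Y := .two) (by simp) (w := w) (rest := cells e) (ρ := regs (cells (w :: e)) (cells f) b [])
    (by simp) rfl

theorem putCell_one (w : List A) (e f : List (List A)) (b : List (Option A)) :
    (putCell tm .one .env).Sends (2 * w.length + 2)
      (bank [] [] (regs (cells e) (cells f) (w.map some) b) fun _ => [])
      (bank [] [] (regs (cells (w.reverse :: e)) (cells f) [] b) fun _ => []) := by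
  simpa using putCell_sends (tm := tm) (i := []) (o := []) (L := fun _ => []) (X := .env)
    (Y := .one) (by simp) (w := w) (ρ := regs (cells e) (cells f) (w.map some) b) rfl

theorem putCell_two (w : List A) (e f : List (List A)) (b : List (Option A)) :
    (putCell tm .two .env).Sends (2 * w.length + 2)
      (bank [] [] (regs (cells e) (cells f) b (w.map some)) fun _ => [])
      (bank [] [] (regs (cells (w.reverse :: e)) (cells f) b []) fun _ => []) := by
  simpa using putCell_sends (tm := tm) (i := []) (o := []) (L := fun _ => []) (X := .env)
    (Y := .two) (by simp) (w := w) (ρ := regs (cells e) (cells f) b (w.map some)) rfl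

/-- Taking a cell reverses it, and putting it back reverses it again. -/
theorem PolyTrans.swap : PolyTrans tm (fun a => x a :: y a :: g a) (fun a => y a :: x a :: g a) :=
  .of_linear ((takeCell tm .env .one).seq ((takeCell tm .env .two).seq
      ((putCell tm .one .env).seq (putCell tm .two .env)))) 4 8
    (fun a => by simp; omega) fun a f => by
    have h1 := takeCell_one (tm := tm) (x a) (y a :: g a) f []
    have h2 := takeCell_two (tm := tm) (y a) (g a) f ((x a).reverse.map some)
    have h3 := putCell_one (tm := tm) (x a).reverse (g a) f ((y a).reverse.map some)
    have h4 := putCell_two (tm := tm) (y a).reverse (x a :: g a) f []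
    rw [List.reverse_reverse] at h3 h4
    refine (Frag.seq_sends h1 (Frag.seq_sends h2 (Frag.seq_sends h3 h4))).mono ?_
    simp; omega

/-- The first word is moved back without an end marker, so its letters land in the cell of the
second word. -/
theorem PolyTrans.append :
    PolyTrans tm (fun a => x a :: y a :: g a) (fun a => (x a ++ y a) :: g a) :=
  .of_linear ((takeCell tm .env .one).seq ((takeCell tm .env .two).seq
      ((putCell tm .two .env).seq (scanLetters tm .one [.env])))) 4 8
    (fun a => by simp; omega) fun a f => by
    have h1 := takeCell_one (tm := tm) (x a) (y a :: g a) f []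
    have h2 := takeCell_two (tm := tm) (y a) (g a) f ((x a).reverse.map some)
    have h3 := putCell_two (tm := tm) (y a).reverse (g a) f ((x a).reverse.map some)
    have h4 := scan_move (tm := tm) (X := .one) (Y := .env) (w := (x a).reverse) (tail := [])
      (i := []) (o := []) (ρ := regs (cells (y a :: g a)) (cells f) ((x a).reverse.map some) [])
      (L := fun _ => []) (by simp) rfl (by simp)
    rw [List.reverse_reverse] at h3 h4
    simp only [update_regs_one, update_regs_env, regs_env] at h4
    refine Frag.Sends.mono (t := _ + (_ + (_ + (2 * (x a).reverse.length + 1))))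
      (Frag.seq_sends h1 (Frag.seq_sends h2 (Frag.seq_sends h3 ?_))) ?_
    · simpa [base] using h4
    · simp; omega

theorem PolyTrans.reverse : PolyTrans tm (fun a => x a :: g a) (fun a => (x a).reverse :: g a) :=
  .of_linear ((takeCell tm .env .one).seq ((scanLetters tm .one [.two]).seq
      (putCell tm .two .env))) 6 6
    (fun a => by simp; omega) fun a f => by
    have h1 := takeCell_one (tm := tm) (x a) (g a) f []
    have h2 := scan_move (tm := tm) (X := .one) (Y := .two) (w := (x a).reverse) (tail := [])
      (i := []) (o := []) (ρ := regs (cells (g a)) (cells f) ((x a).reverse.map some) [])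
      (L := fun _ => []) (by simp) rfl (by simp)
    have h3 := putCell_two (tm := tm) (x a) (g a) f []
    simp only [update_regs_one, update_regs_two, regs_two, List.append_nil,
      List.reverse_reverse] at h2
    refine (Frag.seq_sends h1 (Frag.seq_sends h2 h3)).mono ?_
    simp; omega

/-- One scan writes the word to `env` and to `two`. The copy in `two` has the wrong orientation for
`putCell`, hence the detour through `one`. -/
theorem PolyTrans.dup : PolyTrans tm (fun a => x a :: g a) (fun a => x a :: x a :: g a) :=
  .of_linear ((takeCell tm .env .one).seq ((pushAll tm .env [none]).seq
      ((scanLetters tm .one [.env, .two]).seq ((scanLetters tm .two [.one]).seq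
        (putCell tm .one .env))))) 9 9
    (fun a => by simp; omega) fun a f => by
    have h1 := takeCell_one (tm := tm) (x a) (g a) f []
    have h2 := pushAll_sends (tm := tm) (i := []) (o := []) (L := fun _ => []) .env [none]
      (ρ := regs (cells (g a)) (cells f) ((x a).reverse.map some) [])
    have h3 := scan_copy (tm := tm) (X := .one) (Y := .env) (Z := .two) (w := (x a).reverse)
      (tail := []) (i := []) (o := [])
      (ρ := regs (none :: cells (g a)) (cells f) ((x a).reverse.map some) [])
      (L := fun _ => []) (by simp) (by simp) (by simp) rfl (by simp)
    have h4 := scan_move (tm := tm) (X := .two) (Y := .one) (w := x a) (tail := []) (i := [])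
      (o := []) (ρ := regs (cells (x a :: g a)) (cells f) [] ((x a).map some))
      (L := fun _ => []) (by simp) rfl (by simp)
    have h5 := putCell_one (tm := tm) (x a).reverse (x a :: g a) f []
    simp only [update_regs_one, update_regs_two, update_regs_env, regs_two, regs_one, regs_env,
      List.append_nil, List.reverse_reverse, List.reverse_singleton, List.singleton_append,
      ← cells_cons] at h1 h2 h3 h4 h5
    refine (Frag.seq_sends h1 (Frag.seq_sends h2 (Frag.seq_sends h3
      (Frag.seq_sends h4 h5)))).mono ?_
    simp; omega

end Primitives

end

/-! ### Framing, case distinction, splitting and comparison of words -/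

section

variable {A : Type} {tm : FinTM2} {α β γ : Type}

/-- A frame rule: the top word waits on the second stack while the program runs. The quantifier over
`f` in `PolyTrans` serves this purpose. -/
theorem PolyTrans.weaken {g h : α → List (List A)} (H : PolyTrans tm g h) (y : α → List A) :
    PolyTrans tm (fun a => y a :: g a) (fun a => y a :: h a) := by
  obtain ⟨M, p, hM⟩ := H
  refine ⟨((takeCell tm .env .one).seq (putCell tm .one .frame)).seq
    (M.seq ((takeCell tm .frame .one).seq (putCell tm .one .env))), p + .C 8 * .X + .C 8,
    fun a => ?_⟩
  have hle := eval_mono p (show size (g a) ≤ size (y a :: g a) by simp)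
  simp only [Polynomial.eval_add, Polynomial.eval_mul, Polynomial.eval_C, Polynomial.eval_X]
  refine ⟨?_, fun f => ?_⟩
  · have := (hM a).1
    simp only [size_cons] at hle ⊢
    omega
  · have h1 := takeCell_one (tm := tm) (y a) (g a) f []
    have h2 := putCell_sends (tm := tm) (i := []) (o := []) (L := fun _ => []) (X := .frame)
      (Y := .one) (by simp) (w := (y a).reverse)
      (ρ := regs (cells (g a)) (cells f) ((y a).reverse.map some) []) rfl
    have h3 := (hM a).2 (y a :: f)
    have h4 := takeCell_sends (tm := tm) (i := []) (o := []) (L := fun _ => []) (X := .frame)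
      (Y := .one) (by simp) (w := y a) (rest := cells f)
      (ρ := regs (cells (h a)) (cells (y a :: f)) [] []) (by simp) rfl
    have h5 := putCell_one (tm := tm) (y a).reverse (h a) f []
    simp only [update_regs_one, update_regs_frame, regs_frame, List.reverse_reverse,
      ← cells_cons] at h2 h4 h5
    refine (Frag.seq_sends (Frag.seq_sends h1 h2) (Frag.seq_sends h3
      (Frag.seq_sends h4 h5))).mono ?_
    simp only [size_cons, List.length_reverse] at hle ⊢
    omega

/-- Test the first letter of the top word. -/
def headTestOf (tm : FinTM2) (P : Option A → Bool) : Test (Alph A tm) (IState A tm) :=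
  topTest tm .env .env fun c _ => P c.join

theorem headTestOf_decides (P : Option A → Bool) (w : List A) (e f : List (List A)) {b : Bool}
    (h : P w.head? = b) : (headTestOf tm P).Decides (base tm (w :: e) f) b := by
  refine topTest_decides _ _ _ ?_
  cases w <;> simpa [base] using h

/-- A branch has to be correct only for the parameters that reach it, hence the subtypes. The tested
word is left in place. -/
theorem PolyTrans.ite_head (P : Option A → Bool) {x : α → List A} {g h : α → List (List A)}
    (h₁ : PolyTrans tm (fun a : {a // P (x a).head? = true} => x a :: g a) fun a => h a)
    (h₂ : PolyTrans tm (fun a : {a // P (x a).head? = false} => x a :: g a) fun a => h a) :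
    PolyTrans tm (fun a => x a :: g a) h := by
  obtain ⟨M, p, hM⟩ := h₁
  obtain ⟨N, q, hN⟩ := h₂
  refine ⟨.ite (headTestOf tm P) M N, p + q + 1, fun a => ?_⟩
  simp only [Polynomial.eval_add, Polynomial.eval_one]
  cases hb : P (x a).head? with
  | true =>
    have h := hM ⟨a, hb⟩
    refine ⟨by have := h.1; simp only at this ⊢; omega, fun f => ?_⟩
    exact (Frag.ite_sends_true (headTestOf_decides P _ _ _ hb) (h.2 f)).mono
      (by simp only; omega)
  | false =>
    have h := hN ⟨a, hb⟩
    refine ⟨by have := h.1; simp only at this ⊢; omega, fun f => ?_⟩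
    exact (Frag.ite_sends_false (headTestOf_decides P _ _ _ hb) (h.2 f)).mono
      (by simp only; omega)

theorem PolyTrans.headTest (l : A) (P : Option A → Bool) (x : α → List A)
    (g : α → List (List A)) :
    PolyTrans tm (fun a => x a :: g a) (fun a => boolWord l (P (x a).head?) :: g a) := by
  refine .ite_head P ?_ ?_
  · refine (PolyTrans.drop _ _).trans ?_
    convert PolyTrans.push _ [l] using 3 with a
    simp [a.2, boolWord]
  · refine (PolyTrans.drop _ _).trans ?_
    convert PolyTrans.push _ [] using 3 with a
    simp [a.2, boolWord]

/-- The letters up to the first one that satisfies `e`, inclusively. -/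
def headItem (e : A → Bool) (w : List A) : List A :=
  w.takeWhile (fun c => !e c) ++ (w.dropWhile fun c => !e c).take 1

/-- What is left when `headItem` is removed. -/
def tailItem (e : A → Bool) (w : List A) : List A := (w.dropWhile fun c => !e c).tail

theorem tailItem_true (w : List A) : tailItem (fun _ => true) w = w.tail := by
  cases w <;> simp [tailItem]

theorem headItem_append_tailItem (e : A → Bool) (w : List A) :
    headItem e w ++ tailItem e w = w := by
  rw [headItem, tailItem, List.append_assoc, ← List.drop_one, List.take_append_drop,
    List.takeWhile_append_dropWhile]

theorem PolyTrans.split (e : A → Bool) (x : α → List A) (g : α → List (List A)) :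
    PolyTrans tm (fun a => x a :: g a)
      (fun a => headItem e (x a) :: tailItem e (x a) :: g a) := by
  set T : Test (Alph A tm) (IState A tm) := headTestOf tm fun c => (c.map fun c => !e c).getD false
    with hT
  have hloop : ∀ (w u : List A) (r f : List (List A)),
      (Frag.loop T (popPush tm .env [.one])).Sends (2 * w.length + 1)
        (bank [] [] (regs (cells (w :: r)) (cells f) (u.map some) []) fun _ => [])
        (bank [] [] (regs (cells (w.dropWhile (fun c => !e c) :: r)) (cells f)
          (((w.takeWhile fun c => !e c).reverse ++ u).map some) []) fun _ => []) := by
    intro w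
    induction w with
    | nil =>
      intro u r f
      exact Frag.loop_exit _ (topTest_decides _ _ _ (by simp))
    | cons c w ih =>
      intro u r f
      cases hc : e c with
      | true =>
        have : T.Decides (bank [] [] (regs (cells ((c :: w) :: r)) (cells f) (u.map some) [])
          fun _ => []) false := topTest_decides _ _ _ (by simp [hc])
        simpa [hc] using (Frag.loop_exit (popPush tm .env [.one]) this).mono
          (t' := 2 * (w.length + 1) + 1) (by omega)
      | false =>
        have h0 : T.Decides (bank [] [] (regs (cells ((c :: w) :: r)) (cells f) (u.map some) [])
          fun _ => []) true := topTest_decides _ _ _ (by simp [hc])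
        have h1 := popPush_sends (tm := tm) .env [.one] (i := []) (o := []) (L := fun _ => [])
          (ρ := regs (cells ((c :: w) :: r)) (cells f) (u.map some) []) (c := some c)
          (w := cells (w :: r)) (by simp)
        simp only [List.foldl_cons, List.foldl_nil, update_regs_env, update_regs_one,
          regs_one, ← List.map_cons (f := some)] at h1
        have := Frag.loop_step h0 h1 (ih (c :: u) r f)
        simpa [hc] using this.mono (t' := 2 * (w.length + 1) + 1) (by omega)
  -- The loop halts in front of the first letter of kind `e`, or at the end of the word. The
  -- conditional adds that letter, if there is one, to the item; `pushAll tm .env []` does nothing.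
  refine .of_linear ((Frag.loop T (popPush tm .env [.one])).seq
    ((Frag.ite (headTestOf tm Option.isSome) (popPush tm .env [.one]) (pushAll tm .env [])).seq
      (putCell tm .one .env))) 4 6 (fun a => ?_) fun a f => ?_
  · have := congrArg List.length (headItem_append_tailItem e (x a))
    simp only [List.length_append] at this
    simp only [size_cons]
    omega
  · have hlen := congrArg List.length (headItem_append_tailItem e (x a))
    simp only [List.length_append] at hlen
    have h1 := hloop (x a) [] (g a) f
    have h3 := putCell_one (tm := tm) (headItem e (x a)).reverse (tailItem e (x a) :: g a) f []
    rw [List.reverse_reverse] at h3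
    refine Frag.Sends.mono (Frag.seq_sends h1 (Frag.seq_sends (t := 2) ?_ h3)) ?_
    · cases hd : (x a).dropWhile (fun c => !e c) with
      | nil =>
        refine Frag.ite_sends_false (topTest_decides _ _ _ (by simp)) ?_
        have := pushAll_sends (tm := tm) .env [] (i := []) (o := []) (L := fun _ => [])
          (ρ := regs (cells ([] :: g a)) (cells f)
            (((x a).takeWhile fun c => !e c).reverse.map some) [])
        simpa [headItem, tailItem, hd] using this
      | cons c w =>
        refine Frag.ite_sends_true (topTest_decides _ _ _ (by simp)) ?_
        have := popPush_sends (tm := tm) .env [.one] (i := []) (o := []) (L := fun _ => [])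
          (ρ := regs (cells ((c :: w) :: g a)) (cells f)
            (((x a).takeWhile fun c => !e c).reverse.map some) []) (c := some c)
          (w := cells (w :: g a)) (by simp)
        simpa [headItem, tailItem, hd] using this
    · simp only [size_cons, List.length_reverse]
      omega

-- The words are compared in the two scratch registers by removing their common prefix; they are
-- equal iff nothing remains of either. There they are reversed, which does not affect equality.
open Classical in
theorem PolyTrans.eq (l : A) (x y : α → List A) (g : α → List (List A)) :
    PolyTrans tm (fun a => x a :: y a :: g a)
      (fun a => boolWord l (decide (x a = y a)) :: g a) := by
  set T : Test (Alph A tm) (IState A tm) :=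
    topTest tm .one .two fun c d => isLetter c && decide (c = d) with hT
  set M : Frag (Alph A tm) (IState A tm) := .loop T ((popPush tm .one []).seq (popPush tm .two []))
    with hM
  set N : Frag (Alph A tm) (IState A tm) := .ite
    (topTest tm .one .two fun c d => c.isNone && d.isNone) (pushAll tm .env [none, some l])
    ((scanLetters tm .one []).seq ((scanLetters tm .two []).seq (pushAll tm .env [none]))) with hN
  have hloop : ∀ (u v : List A) (e f : List (List A)),
      (M.seq N).Sends (5 * (u.length + v.length) + 5)
        (bank [] [] (regs (cells e) (cells f) (u.map some) (v.map some)) fun _ => [])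
        (base tm (boolWord l (decide (u = v)) :: e) f) := by
    intro u v e f
    -- After the loop the remainders are both empty or different, so emptiness of both registers
    -- decides equality.
    have hfinish : ∀ u v : List A, (u = [] ∧ v = [] ∨ u ≠ v) →
        N.Sends (2 * (u.length + v.length) + 4)
        (bank [] [] (regs (cells e) (cells f) (u.map some) (v.map some)) fun _ => [])
        (base tm (boolWord l (decide (u = v)) :: e) f) := by
      rintro u v (⟨rfl, rfl⟩ | h)
      · have := pushAll_sends (tm := tm) .env [none, some l] (i := []) (o := [])
          (L := fun _ => []) (ρ := regs (cells e) (cells f) [] [])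
        refine (Frag.ite_sends_true (topTest_decides _ _ _ (by simp)) (S' := _) ?_).mono (t := 2)
          (by simp)
        simpa [base, boolWord] using this
      · have h1 := scan_drop (tm := tm) (X := .one) (w := u) (tail := []) (i := [])
          (o := []) (ρ := regs (cells e) (cells f) (u.map some) (v.map some))
          (L := fun _ => []) rfl (by simp)
        have h2 := scan_drop (tm := tm) (X := .two) (w := v) (tail := []) (i := [])
          (o := []) (ρ := regs (cells e) (cells f) [] (v.map some))
          (L := fun _ => []) rfl (by simp)
        have h3 := pushAll_sends (tm := tm) .env [none] (i := []) (o := [])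
          (L := fun _ => []) (ρ := regs (cells e) (cells f) [] [])
        simp only [update_regs_one, update_regs_two, update_regs_env] at h1 h2 h3
        have h0 : (topTest (A := A) tm .one .two fun c d => c.isNone && d.isNone).Decides
            (bank [] [] (regs (cells e) (cells f) (u.map some) (v.map some)) fun _ => [])
            false := topTest_decides _ _ _ (by cases u <;> cases v <;> simp at h ⊢)
        have := Frag.ite_sends_false (M := pushAll tm .env [none, some l]) h0
          (Frag.seq_sends h1 (Frag.seq_sends h2 h3))
        rw [decide_eq_false h]
        simpa [base, boolWord] using this.mono (t' := 2 * (u.length + v.length) + 4) (by omega)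
    have key : ∀ u v : List A, ∃ u' v' : List A, (u' = [] ∧ v' = [] ∨ u' ≠ v') ∧
        (u' = v' ↔ u = v) ∧ u'.length ≤ u.length ∧ v'.length ≤ v.length ∧
        M.Sends (3 * u.length + 1)
          (bank [] [] (regs (cells e) (cells f) (u.map some) (v.map some)) fun _ => [])
          (bank [] [] (regs (cells e) (cells f) (u'.map some) (v'.map some)) fun _ => []) := by
      intro u
      induction u with
      | nil =>
        intro v
        refine ⟨[], v, ?_, by simp, by simp, by simp,
          Frag.loop_exit _ (topTest_decides _ _ _ (by simp [isLetter]))⟩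
        cases v <;> simp
      | cons c u ih =>
        intro v
        by_cases hcd : v.head? = some c
        · obtain ⟨v, rfl⟩ : ∃ v', v = c :: v' := by
            cases v with
            | nil => simp at hcd
            | cons d v => exact ⟨v, by simpa using hcd⟩
          obtain ⟨u', v', h1, h2, h3, h4, h5⟩ := ih v
          refine ⟨u', v', h1, by simp [h2], by simp; omega, by simp; omega, ?_⟩
          have k1 := popPush_sends (tm := tm) .one [] (i := []) (o := []) (L := fun _ => [])
            (ρ := regs (cells e) (cells f) ((c :: u).map some) ((c :: v).map some))
            (c := some c) (w := u.map some) (by simp)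
          have k2 := popPush_sends (tm := tm) .two [] (i := []) (o := []) (L := fun _ => [])
            (ρ := regs (cells e) (cells f) (u.map some) ((c :: v).map some))
            (c := some c) (w := v.map some) (by simp)
          simp only [List.foldl_nil, update_regs_one, update_regs_two] at k1 k2
          have k0 : T.Decides (bank [] [] (regs (cells e) (cells f) ((c :: u).map some)
            ((c :: v).map some)) fun _ => []) true :=
              topTest_decides _ _ _ (by simp [isLetter])
          exact (Frag.loop_step k0 (Frag.seq_sends k1 k2) h5).mono (by simp; omega)
        · have hne : c :: u ≠ v := by rintro rfl; simp at hcd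
          refine ⟨c :: u, v, .inr hne, by simp, le_rfl, le_rfl,
            (Frag.loop_exit _ (topTest_decides _ _ _ ?_)).mono (by simp)⟩
          cases v with
          | nil => simp [isLetter]
          | cons d v =>
            have : c ≠ d := fun h => hcd (by simp [h])
            simp [isLetter, this]
    obtain ⟨u', v', h1, h2, h3, h4, h5⟩ := key u v
    have := hfinish u' v' h1
    rw [decide_eq_decide.mpr h2] at this
    exact (Frag.seq_sends h5 this).mono (by omega)
  refine .of_linear ((takeCell tm .env .one).seq ((takeCell tm .env .two).seq (M.seq N))) 7 9
    (fun a => ?_) fun a f => ?_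
  · have : (boolWord l (decide (x a = y a))).length ≤ 1 := by
      unfold boolWord
      split <;> simp
    simp only [size_cons]
    omega
  · have h1 := takeCell_one (tm := tm) (x a) (y a :: g a) f []
    have h2 := takeCell_two (tm := tm) (y a) (g a) f ((x a).reverse.map some)
    have h3 := hloop (x a).reverse (y a).reverse (g a) f
    simp only [List.reverse_inj] at h3
    refine (Frag.seq_sends h1 (Frag.seq_sends h2 h3)).mono ?_
    simp; omega

end

/-! ### Iteration over coded lists, and the calculus of polynomial-time functions -/

section

variable {A : Type} {tm : FinTM2} {α β γ : Type}

/-- The list is stored as one word; the letters of kind `e` end the items, so `split` detaches the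
next one. Iterating a polynomial-time body can produce exponential growth, and `hq` excludes this by
bounding every intermediate accumulator in terms of the initial stack. -/
theorem PolyTrans.fold (e : A → Bool) (code : β → List A)
    (hcode : ∀ b, ∃ w c, code b = w ++ [c] ∧ (∀ d ∈ w, e d = false) ∧ e c = true)
    (st : γ → List A) (L : α → List β) (init : α → γ) (step : α → β → γ → γ)
    (g : α → List (List A))
    (hbody : PolyTrans tm
      (fun q : α × β × List β × γ => code q.2.1 :: q.2.2.1.flatMap code :: st q.2.2.2 :: g q.1)
      (fun q => st (step q.1 q.2.1 q.2.2.2) :: code q.2.1 :: q.2.2.1.flatMap code :: st q.2.2.2 ::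
        g q.1))
    (q : Polynomial ℕ)
    (hq : ∀ a l₁ l₂, L a = l₁ ++ l₂ →
      (st (l₁.foldl (fun c b => step a b c) (init a))).length ≤
        q.eval (size ((L a).flatMap code :: st (init a) :: g a))) :
    PolyTrans tm (fun a => (L a).flatMap code :: st (init a) :: g a)
      (fun a => st ((L a).foldl (fun c b => step a b c) (init a)) :: g a) := by
  have hsplit : ∀ (b : β) (l : List A),
      headItem e (code b ++ l) = code b ∧ tailItem e (code b ++ l) = l := by
    intro b l
    obtain ⟨w, c, hb, hw, hc⟩ := hcode b
    have hw' : ∀ d ∈ w, (!e d) = true := fun d hd => by simp [hw d hd]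
    rw [headItem, tailItem, hb, List.append_assoc, List.takeWhile_append_of_pos hw',
      List.dropWhile_append_of_pos hw']
    simp [hc]
  have hpos : ∀ l : List β, l.length ≤ (l.flatMap code).length := by
    intro l
    induction l with
    | nil => simp
    | cons b l ih =>
      obtain ⟨w, c, hb, -, -⟩ := hcode b
      simp only [List.length_cons, List.flatMap_cons, List.length_append, hb]
      simp only [List.length_nil]
      omega
  have hiter : PolyTrans tm
      (fun q : α × β × List β × γ => (q.2.1 :: q.2.2.1).flatMap code :: st q.2.2.2 :: g q.1)
      (fun q => q.2.2.1.flatMap code :: st (step q.1 q.2.1 q.2.2.2) :: g q.1) := by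
    have h1 := PolyTrans.split (tm := tm) e
      (fun q : α × β × List β × γ => (q.2.1 :: q.2.2.1).flatMap code)
      (fun q => st q.2.2.2 :: g q.1)
    simp only [List.flatMap_cons, hsplit] at h1 ⊢
    refine h1.trans (hbody.trans ?_)
    -- The body leaves its arguments in place below the new accumulator; the item and the old
    -- accumulator are removed.
    refine ((PolyTrans.drop _ _).weaken _).trans ((PolyTrans.swap _ _ _).trans ?_)
    exact ((PolyTrans.drop _ _).weaken _).weaken _
  obtain ⟨B, p, hB⟩ := hiter
  obtain ⟨D, d, hD⟩ := PolyTrans.drop (tm := tm) (fun _ : α => ([] : List A))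
    (fun a => st ((L a).foldl (fun c b => step a b c) (init a)) :: g a)
  set T : Test (Alph A tm) (IState A tm) := headTestOf tm Option.isSome
  -- `X + q + 1` bounds the stack before every round, and `X` bounds the number of rounds, because
  -- each item has at least one letter. `D` removes the exhausted list.
  refine ⟨(Frag.loop T B).seq D, .X * (p.comp (.X + q + 1) + 1) + 1 + d.comp (.X + q + 1) +
    (.X + q + 1), fun a => ?_⟩
  set N := size ((L a).flatMap code :: st (init a) :: g a) with hN
  have hsize : ∀ l₁ l₂, L a = l₁ ++ l₂ →
      size (l₂.flatMap code :: st (l₁.foldl (fun c b => step a b c) (init a)) :: g a) ≤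
        N + q.eval N + 1 := by
    intro l₁ l₂ h
    have h1 := hq a l₁ l₂ h
    rw [← hN] at h1
    have h2 : N = ((L a).flatMap code).length + 1 + ((st (init a)).length + 1 + size (g a)) := by
      simp [hN]
    rw [h] at h2
    simp only [List.flatMap_append, List.length_append] at h2
    simp only [size_cons]
    omega
  have hlast := hsize (L a) [] (by simp)
  have hloop : ∀ (l₂ l₁ : List β) (f : List (List A)), L a = l₁ ++ l₂ →
      (Frag.loop T B).Sends (l₂.length * (p.eval (N + q.eval N + 1) + 1) + 1)
        (base tm (l₂.flatMap code :: st (l₁.foldl (fun c b => step a b c) (init a)) :: g a) f)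
        (base tm ([] :: st ((L a).foldl (fun c b => step a b c) (init a)) :: g a) f) := by
    intro l₂
    induction l₂ with
    | nil =>
      intro l₁ f h
      rw [List.append_nil] at h
      rw [h]
      exact (Frag.loop_exit _ (headTestOf_decides _ _ _ _ (by simp))).mono (by simp)
    | cons b l₂ ih =>
      intro l₁ f h
      have h1 := (hB (a, b, l₂, l₁.foldl (fun c b => step a b c) (init a))).2 f
      have h2 := ih (l₁ ++ [b]) f (by simp [h])
      have hT : T.Decides (base tm ((b :: l₂).flatMap code ::
          st (l₁.foldl (fun c b => step a b c) (init a)) :: g a) f) true :=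
        headTestOf_decides _ _ _ _ (by
          obtain ⟨w, c, hb, -, -⟩ := hcode b
          cases w <;> simp [hb])
      simp only [List.foldl_append, List.foldl_cons, List.foldl_nil] at h2
      refine (Frag.loop_step hT h1 h2).mono ?_
      have := eval_mono p (hsize l₁ (b :: l₂) h)
      simp only at this
      simp only [List.length_cons, Nat.add_mul]
      omega
  have hlen : (L a).length ≤ N := by
    have := hpos (L a)
    simp only [hN, size_cons]
    omega
  have hmul := Nat.mul_le_mul_right (p.eval (N + q.eval N + 1) + 1) hlen
  simp only [Polynomial.eval_add, Polynomial.eval_mul, Polynomial.eval_comp, Polynomial.eval_X,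
    Polynomial.eval_one]
  refine ⟨?_, fun f => ?_⟩
  · simp only [size_cons, List.flatMap_nil, List.length_nil] at hlast ⊢
    omega
  · have h1 := hloop (L a) [] f (by simp)
    have h2 := (hD a).2 f
    refine (Frag.seq_sends h1 h2).mono ?_
    have := eval_mono d hlast
    simp only [List.flatMap_nil] at this ⊢
    omega

/-! ### Polynomial-time functions of a stack of words -/

/-- The word `x a` can be computed in polynomial time from the stack `g a`. -/
def PolyFun (tm : FinTM2) (g : α → List (List A)) (x : α → List A) : Prop :=
  PolyTrans tm g fun a => x a :: g a

namespace PolyFun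

variable {g : α → List (List A)} {x y z : α → List A}

theorem const (w : List A) : PolyFun tm g fun _ => w := PolyTrans.push g w

theorem top : PolyFun tm (fun a => x a :: g a) x := PolyTrans.dup x g

theorem weaken (h : PolyFun tm g x) (y : α → List A) : PolyFun tm (fun a => y a :: g a) x :=
  (PolyTrans.weaken h y).trans (PolyTrans.swap _ _ _)

theorem comap (h : PolyFun tm g x) (i : β → α) :
    PolyFun tm (fun b => g (i b)) fun b => x (i b) := PolyTrans.comap h i

theorem unary {f : List A → List A}
    (hf : ∀ {α : Type} (x : α → List A) (g : α → List (List A)),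
      PolyTrans tm (fun a => x a :: g a) fun a => f (x a) :: g a)
    (hx : PolyFun tm g x) : PolyFun tm g fun a => f (x a) :=
  PolyTrans.trans hx (hf x g)

theorem binary {f : List A → List A → List A}
    (hf : ∀ {α : Type} (x y : α → List A) (g : α → List (List A)),
      PolyTrans tm (fun a => x a :: y a :: g a) fun a => f (x a) (y a) :: g a)
    (hx : PolyFun tm g x) (hy : PolyFun tm g y) : PolyFun tm g fun a => f (x a) (y a) :=
  PolyTrans.trans hy (PolyTrans.trans (hx.weaken y) (hf x y g))

theorem append (hx : PolyFun tm g x) (hy : PolyFun tm g y) : PolyFun tm g fun a => x a ++ y a :=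
  binary (fun x y g => PolyTrans.append x y g) hx hy

theorem reverse (hx : PolyFun tm g x) : PolyFun tm g fun a => (x a).reverse :=
  unary (fun x g => PolyTrans.reverse x g) hx

theorem headTest (l : A) (P : Option A → Bool) (hx : PolyFun tm g x) :
    PolyFun tm g fun a => boolWord l (P (x a).head?) :=
  PolyTrans.trans hx (PolyTrans.headTest l P x g)

theorem headItem (e : A → Bool) (hx : PolyFun tm g x) :
    PolyFun tm g fun a => headItem e (x a) :=
  PolyTrans.trans hx (PolyTrans.trans (PolyTrans.split e x g) ((PolyTrans.drop _ _).weaken _))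

theorem tailItem (e : A → Bool) (hx : PolyFun tm g x) :
    PolyFun tm g fun a => tailItem e (x a) :=
  PolyTrans.trans hx (PolyTrans.trans (PolyTrans.split e x g) (PolyTrans.drop _ _))

open Classical in
theorem eq (l : A) (hx : PolyFun tm g x) (hy : PolyFun tm g y) :
    PolyFun tm g fun a => boolWord l (decide (x a = y a)) :=
  binary (f := fun x y => boolWord l (decide (x = y))) (fun x y g => PolyTrans.eq l x y g) hx hy

theorem ite_head (P : Option A → Bool) (hx : PolyFun tm g x) (hy : PolyFun tm g y)
    (hz : PolyFun tm g z) : PolyFun tm g fun a => if P (x a).head? = true then y a else z a := by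
  refine PolyTrans.trans hx (PolyTrans.ite_head P ?_ ?_)
  · have := PolyTrans.trans (PolyTrans.drop (tm := tm) x g) hy
    convert this.comap (Subtype.val : {a // P (x a).head? = true} → α) using 3 with a
    simp [a.2]
  · have := PolyTrans.trans (PolyTrans.drop (tm := tm) x g) hz
    convert this.comap (Subtype.val : {a // P (x a).head? = false} → α) using 3 with a
    simp [a.2]

/-- Over a finite alphabet the case distinction is a chain of tests, one for each letter. -/
theorem switch [Finite A] {X : A → α → List A} (hx : PolyFun tm g x)
    (hX : ∀ c, PolyFun tm g (X c)) (hy : PolyFun tm g y) :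
    PolyFun tm g fun a => (x a).head?.elim (y a) fun c => X c a := by
  classical
  have : Fintype A := Fintype.ofFinite A
  have key : ∀ l : List A, PolyFun tm g fun a =>
      if ∃ c ∈ l, (x a).head? = some c then (x a).head?.elim (y a) (fun c => X c a) else y a := by
    intro l
    induction l with
    | nil => simpa using hy
    | cons c l ih =>
      convert ite_head (fun d => decide (d = some c)) hx (hX c) ih using 2 with a
      by_cases h : (x a).head? = some c
      · simp [h]
      · simp [h]
  convert key Finset.univ.toList using 2 with a
  cases h : (x a).head? <;> simp

theorem fold (e : A → Bool) (code : β → List A)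
    (hcode : ∀ b, ∃ w c, code b = w ++ [c] ∧ (∀ d ∈ w, e d = false) ∧ e c = true)
    (st : γ → List A) {L : α → List β} {init : α → γ} {step : α → β → γ → γ}
    (hL : PolyFun tm g fun a => (L a).flatMap code) (hinit : PolyFun tm g fun a => st (init a))
    (hbody : PolyFun tm
      (fun q : α × β × List β × γ => code q.2.1 :: q.2.2.1.flatMap code :: st q.2.2.2 :: g q.1)
      (fun q => st (step q.1 q.2.1 q.2.2.2)))
    (q : Polynomial ℕ)
    (hq : ∀ a l₁ l₂, L a = l₁ ++ l₂ →
      (st (l₁.foldl (fun c b => step a b c) (init a))).length ≤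
        q.eval (size ((L a).flatMap code :: st (init a) :: g a))) :
    PolyFun tm g fun a => st ((L a).foldl (fun c b => step a b c) (init a)) :=
  PolyTrans.trans hinit (PolyTrans.trans (hL.weaken _)
    (PolyTrans.fold e code hcode st L init step g hbody q hq))

end PolyFun

end

section

/-! ### Running the embedded machine -/

section Embedded

variable {A : Type} {tm : FinTM2}

/-- A statement of the embedded machine, as a statement of the whole machine. -/
def liftStmt (A : Type) : TM2.Stmt tm.Γ tm.Λ tm.σ → TM2.Stmt (Alph A tm) tm.Λ (IState A tm)
  | .push k f q => .push (.ext k) (fun v => f v.2) (liftStmt A q)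
  | .peek k f q => .peek (.ext k) (fun v c => (v.1, f v.2 c)) (liftStmt A q)
  | .pop k f q => .pop (.ext k) (fun v c => (v.1, f v.2 c)) (liftStmt A q)
  | .load f q => .load (fun v => (v.1, f v.2)) (liftStmt A q)
  | .branch f q₁ q₂ => .branch (fun v => f v.2) (liftStmt A q₁) (liftStmt A q₂)
  | .goto f => .goto fun v => f v.2
  | .halt => .halt

/-- A configuration of the embedded machine, as one of the whole machine. -/
def liftCfg (u : Option (Option A) × Option (Option A)) (i : List A) (o : List Bool)
    (ρ : Reg → List (Option A)) (c : TM2.Cfg tm.Γ tm.Λ tm.σ) :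
    TM2.Cfg (Alph A tm) tm.Λ (IState A tm) :=
  ⟨c.l, (u, c.var), bank i o ρ c.stk⟩

variable {u : Option (Option A) × Option (Option A)} {i : List A} {o : List Bool}
  {ρ : Reg → List (Option A)}

theorem stepAux_liftStmt (q : TM2.Stmt tm.Γ tm.Λ tm.σ) (v : tm.σ) (L : ∀ k, List (tm.Γ k)) :
    TM2.stepAux (liftStmt A q) (u, v) (bank i o ρ L) =
      liftCfg u i o ρ (TM2.stepAux q v L) := by
  induction q generalizing v L with
  | push k g q ih => simp [liftStmt, ih]
  | peek k g q ih => simp [liftStmt, ih]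
  | pop k g q ih => simp [liftStmt, ih]
  | load g q ih => simp [liftStmt, ih]
  | branch g q₁ q₂ ih₁ ih₂ => cases h : g v <;> simp [liftStmt, h, ih₁, ih₂]
  | goto g => simp [liftStmt, liftCfg]
  | halt => simp [liftStmt, liftCfg]

theorem Steps.lift {n : ℕ} {c c' : TM2.Cfg tm.Γ tm.Λ tm.σ} (h : Steps tm.m n c c') :
    Steps (fun l => liftStmt A (tm.m l)) n (liftCfg u i o ρ c) (liftCfg u i o ρ c') := by
  induction h with
  | refl => exact .refl _
  | @head n l v S c _ ih =>
    refine .head (l := l) ?_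
    rwa [stepAux_liftStmt]

/-- Start the embedded machine, and run it until it halts. -/
def runEmbedded (A : Type) (tm : FinTM2) : Frag (Alph A tm) (IState A tm) where
  Λ := Option tm.Λ
  fin := letI := tm.ΛFin; inferInstance
  entry := none
  m
    | none => .load (fun v => (v.1, tm.initialState)) (.goto fun _ => some tm.main)
    | some l => relabel some none (liftStmt A (tm.m l))

theorem initList_stk (s : List (tm.Γ tm.k₀)) :
    (initList tm s).stk = Function.update (fun _ => []) tm.k₀ s := by
  funext k
  by_cases h : k = tm.k₀
  · subst h; simp [initList]
  · simp [initList, h]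

theorem haltList_stk (s : List (tm.Γ tm.k₁)) :
    (haltList tm s).stk = Function.update (fun _ => []) tm.k₁ s := by
  funext k
  by_cases h : k = tm.k₁
  · subst h; simp [haltList]
  · simp [haltList, h]

/-- A halting configuration has empty stacks apart from the output. Once the output is fetched, the
machine can therefore be called again, any number of times. -/
theorem runEmbedded_sends {s : List (tm.Γ tm.k₀)} {s' : List (tm.Γ tm.k₁)} {t : ℕ}
    (h : TM2OutputsInTime tm s (some s') t) :
    (runEmbedded A tm).Sends (t + 1)
      (bank i o ρ (Function.update (fun _ => []) tm.k₀ s))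
      (bank i o ρ (Function.update (fun _ => []) tm.k₁ s')) := by
  intro v
  have h1 : Steps tm.m h.steps (initList tm s) (haltList tm s') :=
    steps_of_iterate h.evals_in_steps
  have h2 := (h1.lift (A := A) (u := v.1) (i := i) (o := o) (ρ := ρ)).relabel
    (m' := (runEmbedded A tm).m) (f := some) (e := none) fun _ => rfl
  refine ⟨(v.1, tm.initialState), h.steps + 1, Nat.succ_le_succ h.steps_le_m, .head ?_⟩
  rw [← initList_stk, ← haltList_stk]
  exact h2

/-- Push a symbol onto a stack of the embedded machine. -/
def pushExt (A : Type) (k : tm.K) (c : tm.Γ k) : Frag (Alph A tm) (IState A tm) :=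
  .basic (.push (.ext k) (fun _ => c) .halt)

/-- Move a symbol from a register to a stack of the embedded machine. -/
def feedStep (X : Reg) (k : tm.K) (f : Option A → tm.Γ k) : Frag (Alph A tm) (IState A tm) :=
  .basic (.pop (.reg X) (fun v c => ((c, v.1.2), v.2))
    (.push (.ext k) (fun v => f (v.1.1.getD none)) .halt))

/-- Move the contents of a register to a stack of the embedded machine. -/
def feed (X : Reg) (k : tm.K) (f : Option A → tm.Γ k) : Frag (Alph A tm) (IState A tm) :=
  .loop (topTest tm X X fun c _ => isLetter c) (feedStep X k f)

theorem feed_sends (X : Reg) (k : tm.K) (f : Option A → tm.Γ k) (w : List A)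
    (hX : ρ X = w.map some) (s : List (tm.Γ k)) :
    (feed X k f).Sends (2 * w.length + 1)
      (bank i o ρ (Function.update (fun _ => []) k s))
      (bank i o (Function.update ρ X [])
        (Function.update (fun _ => []) k ((w.map fun c => f (some c)).reverse ++ s))) := by
  induction w generalizing ρ s with
  | nil =>
    have hρ : Function.update ρ X [] = ρ := by
      rw [← List.map_nil, ← hX, Function.update_eq_self]
    rw [hρ]
    exact Frag.loop_exit _ (topTest_decides _ _ _ (by simp [hX, isLetter]))
  | cons c w ih =>
    have h := ih (ρ := Function.update ρ X (w.map some)) (by simp) (f (some c) :: s)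
    have hT : (topTest (A := A) tm X X fun c _ => isLetter c).Decides
        (bank i o ρ (Function.update (fun _ => []) k s)) true :=
      topTest_decides _ _ _ (by simp [hX, isLetter])
    have hM : (feedStep X k f).Sends 1 (bank i o ρ (Function.update (fun _ => []) k s))
        (bank i o (Function.update ρ X (w.map some))
          (Function.update (fun _ => []) k (f (some c) :: s))) :=
      Frag.basic_sends fun v => ⟨((some (some c), v.1.2), v.2), by simp [hX]⟩
    have := Frag.loop_step hT hM h
    simpa [feed] using this.mono (t' := 2 * (c :: w).length + 1) (by simp; omega)

/-- Make the Boolean output of the embedded machine the top cell. -/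
def fetch (l : A) (f : tm.Γ tm.k₁ → Bool) : Frag (Alph A tm) (IState A tm) :=
  .basic (.pop (.ext tm.k₁) (fun v c =>
    ((if c.map f = some true then some none else none, none), v.2))
    (.push (.reg .env) (fun _ => none)
      (.branch (fun v => v.1.1.isSome) (.push (.reg .env) (fun _ => some l) .halt) .halt)))

/-- The first state component serves as a flag: `some none` stands for true, `none` for false. -/
theorem fetch_sends (l : A) (f : tm.Γ tm.k₁ → Bool) (c : tm.Γ tm.k₁) (e e' : List (List A)) :
    (fetch l f).Sends 1
      (bank [] [] (regs (cells e) (cells e') [] []) (Function.update (fun _ => []) tm.k₁ [c]))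
      (base tm (boolWord l (f c) :: e) e') := by
  refine Frag.basic_sends fun v =>
    ⟨((if f c = true then some none else none, none), v.2), ?_⟩
  cases h : f c <;> simp [base, boolWord, h]

/-- The input stack of the embedded machine is filled from the bottom: second constant, separator `F
none`, first constant. Each word is reversed by `takeCell` and again by `feed`. -/
theorem PolyTrans.embedded {𝒰 α : Type} {enc : 𝒰 → List Bool} {R : 𝒰 × 𝒰 → Bool}
    (H : TM2ComputableInPolyTime (encodePair enc) Computability.encodeBool R)
    (l : A) (bit : Bool → A) (unbit : A → Bool) (hbit : ∀ b, unbit (bit b) = b)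
    (x y : α → 𝒰) (g : α → List (List A)) :
    PolyTrans H.tm (fun a => (enc (x a)).map bit :: (enc (y a)).map bit :: g a)
      (fun a => boolWord l (R (x a, y a)) :: g a) := by
  set F : Option A → H.tm.Γ H.tm.k₀ := fun c => H.inputAlphabet.symm (c.map unbit) with hF
  refine ⟨(takeCell H.tm .env .one).seq ((takeCell H.tm .env .two).seq ((feed .two _ F).seq
    ((pushExt A H.tm.k₀ (F none)).seq ((feed .one _ F).seq ((runEmbedded A H.tm).seq
      (fetch l H.outputAlphabet)))))), .C 4 * .X + .C 9 + H.time, fun a => ?_⟩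
  simp only [Polynomial.eval_add, Polynomial.eval_mul, Polynomial.eval_C, Polynomial.eval_X]
  refine ⟨?_, fun f => ?_⟩
  · have : (boolWord l (R (x a, y a))).length ≤ 1 := by
      unfold boolWord
      split <;> simp
    simp only [size_cons]
    omega
  · have h1 := takeCell_one (tm := H.tm) ((enc (x a)).map bit) ((enc (y a)).map bit :: g a) f []
    have h2 := takeCell_two (tm := H.tm) ((enc (y a)).map bit) (g a) f
      (((enc (x a)).map bit).reverse.map some)
    have h3 := feed_sends (tm := H.tm) (i := []) (o := []) .two _ F ((enc (y a)).map bit).reverse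
      (ρ := regs (cells (g a)) (cells f) (((enc (x a)).map bit).reverse.map some)
        (((enc (y a)).map bit).reverse.map some)) rfl []
    have h4 : (pushExt A H.tm.k₀ (F none)).Sends 1
        (bank [] [] (regs (cells (g a)) (cells f) (((enc (x a)).map bit).reverse.map some) [])
          (Function.update (fun _ => []) H.tm.k₀ ((enc (y a)).map fun b => F (some (bit b)))))
        (bank [] [] (regs (cells (g a)) (cells f) (((enc (x a)).map bit).reverse.map some) [])
          (Function.update (fun _ => []) H.tm.k₀
            (F none :: (enc (y a)).map fun b => F (some (bit b))))) :=
      Frag.basic_sends fun v => ⟨v, by simp⟩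
    have h5 := feed_sends (tm := H.tm) (i := []) (o := []) .one _ F ((enc (x a)).map bit).reverse
      (ρ := regs (cells (g a)) (cells f) (((enc (x a)).map bit).reverse.map some) []) rfl
      (F none :: (enc (y a)).map fun b => F (some (bit b)))
    have h6 := runEmbedded_sends (A := A) (i := []) (o := [])
      (ρ := regs (cells (g a)) (cells f) [] []) (H.outputsFun (x a, y a))
    have h7 := fetch_sends (tm := H.tm) l H.outputAlphabet
      (H.outputAlphabet.symm (R (x a, y a))) (g a) f
    have hin : (((enc (x a)).map fun b => F (some (bit b))) ++ F none ::
        (enc (y a)).map fun b => F (some (bit b))) =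
        (encodePair enc (x a, y a)).map H.inputAlphabet.invFun := by
      simp [encodePair, hF, hbit, Function.comp_def]
    simp only [update_regs_two, update_regs_one, List.map_reverse, List.reverse_reverse,
      List.map_map, List.append_nil, Function.comp_def, List.length_reverse,
      List.length_map] at h1 h2 h3 h4 h5
    rw [hin] at h5
    rw [show Function.update (fun _ => []) H.tm.k₀ ([] : List (H.tm.Γ H.tm.k₀)) = fun _ => [] from
      Function.update_eq_self_iff.mpr rfl] at h3
    simp only [Equiv.apply_symm_apply] at h7
    refine Frag.Sends.mono (Frag.seq_sends h1 (Frag.seq_sends h2 (Frag.seq_sends h3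
      (Frag.seq_sends h4 (Frag.seq_sends h5 (Frag.seq_sends h6 h7)))))) ?_
    have hle : (encodePair enc (x a, y a)).length ≤
        size ((enc (x a)).map bit :: (enc (y a)).map bit :: g a) := by
      simp [encodePair]
      omega
    have := eval_mono H.time hle
    simp only [size_cons, List.length_map] at this ⊢
    omega

end Embedded

/-! ### The complete machine -/

section Complete

variable {A : Type} {tm : FinTM2}

/-- Does the input have a further letter? -/
def inputTest (A : Type) (tm : FinTM2) : Test (Alph A tm) (IState A tm) where
  pre q := .peek .input (fun v c => ((c.map some, v.1.2), v.2)) q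
  cond v := v.1.1.isSome

theorem inputTest_decides (i : List A) (o : List Bool) (ρ : Reg → List (Option A))
    (L : ∀ k, List (tm.Γ k)) : (inputTest A tm).Decides (bank i o ρ L) i.head?.isSome := fun v =>
  ⟨((i.head?.map some, v.1.2), v.2), by simp [inputTest], fun Λ q => by simp [inputTest]⟩

/-- Move a letter of the input to the register `env`. -/
def readLetter (A : Type) (tm : FinTM2) : Frag (Alph A tm) (IState A tm) :=
  .basic (.pop .input (fun v c => ((c.map some, v.1.2), v.2))
    (.push (.reg .env) (fun v => v.1.1.getD none) .halt))

/-- Make the input, in reversed order, the only cell. -/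
def readInput (A : Type) (tm : FinTM2) : Frag (Alph A tm) (IState A tm) :=
  (pushAll tm .env [none]).seq (.loop (inputTest A tm) (readLetter A tm))

/-- Letters are pushed as they are read, so the input arrives reversed. The codes of facts and
updates are reversed for this reason, and hence end with their header letter. -/
theorem readInput_sends (w : List A) :
    (readInput A tm).Sends (2 * w.length + 2)
      (bank w [] (regs [] [] [] []) fun _ => []) (base tm [w.reverse] []) := by
  have h1 := pushAll_sends (tm := tm) .env [none] (i := w) (o := [])
    (L := fun _ => []) (ρ := regs [] [] [] [])
  have h2 : ∀ w u : List A, (Frag.loop (inputTest A tm) (readLetter A tm)).Sends (2 * w.length + 1)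
      (bank w [] (regs (cells [u]) [] [] []) fun _ => [])
      (bank [] [] (regs (cells [w.reverse ++ u]) [] [] []) fun _ => []) := by
    intro w
    induction w with
    | nil => exact fun u => Frag.loop_exit _ (inputTest_decides _ _ _ _)
    | cons c w ih =>
      intro u
      have hM : (readLetter A tm).Sends 1
          (bank (c :: w) [] (regs (cells [u]) [] [] []) fun _ => [])
          (bank w [] (regs (cells [c :: u]) [] [] []) fun _ => []) :=
        Frag.basic_sends fun v => ⟨((some (some c), v.1.2), v.2), by simp⟩
      have := Frag.loop_step (inputTest_decides _ _ _ _) hM (ih (c :: u))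
      simpa using this.mono (t' := 2 * (w.length + 1) + 1) (by omega)
  have := h2 w []
  simp only [List.append_nil] at this
  rw [update_regs_env] at h1
  have h3 := Frag.seq_sends h1 this
  exact h3.mono (by omega)

/-- Output the truth value in the top cell. -/
def writeBool (A : Type) (tm : FinTM2) : Frag (Alph A tm) (IState A tm) :=
  .basic (.peek (.reg .env) (fun v c => ((c, v.1.2), v.2))
    (.push .output (fun v => isLetter v.1.1) .halt))

/-- Output the truth value in the top cell, and clear the register. -/
def writeOutput (A : Type) (tm : FinTM2) : Frag (Alph A tm) (IState A tm) :=
  (writeBool A tm).seq (.loop (topTest tm .env .env fun c _ => c.isSome) (popPush tm .env []))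

theorem writeOutput_sends (l : A) (b : Bool) (e : List (List A)) :
    (writeOutput A tm).Sends (2 * size (boolWord l b :: e) + 2)
      (base tm (boolWord l b :: e) []) (bank [] [b] (regs [] [] [] []) fun _ => []) := by
  have h2 : ∀ w : List (Option A), (Frag.loop (topTest tm .env .env fun c _ => c.isSome)
      (popPush tm .env [])).Sends (2 * w.length + 1)
      (bank [] [b] (regs w [] [] []) fun _ => [])
      (bank [] [b] (regs [] [] [] []) fun _ => []) := by
    intro w
    induction w with
    | nil => exact Frag.loop_exit _ (topTest_decides _ _ _ rfl)
    | cons c w ih =>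
      have h := popPush_sends (tm := tm) .env [] (i := []) (o := [b]) (L := fun _ => [])
        (ρ := regs (c :: w) [] [] []) (c := c) (w := w) rfl
      simp only [List.foldl_nil, update_regs_env] at h
      refine (Frag.loop_step (topTest_decides _ _ _ rfl) h ih).mono ?_
      simp; omega
  have h1 : (writeBool A tm).Sends 1 (base tm (boolWord l b :: e) [])
      (bank [] [b] (regs (cells (boolWord l b :: e)) [] [] []) fun _ => []) :=
    Frag.basic_sends fun v => ⟨(((cells (boolWord l b :: e)).head?, v.1.2), v.2), by
      cases b <;> simp [base, boolWord, isLetter]⟩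
  have h3 := Frag.seq_sends h1 (h2 (cells (boolWord l b :: e)))
  exact h3.mono (by rw [size]; omega)

/-- The machine that executes a fragment on its input, and outputs the truth value computed. -/
noncomputable def machine [Finite A] (M : Frag (Alph A tm) (IState A tm)) : FinTM2 where
  K := Tape tm.K
  kFin := letI := tm.kFin; Fintype.ofFinite _
  k₀ := .input
  k₁ := .output
  Γ := Alph A tm
  Λ := Option M.Λ
  main := some M.entry
  ΛFin := letI := M.fin; inferInstance
  σ := IState A tm
  initialState := ((none, none), tm.initialState)
  σFin := letI := tm.σFin; letI := Fintype.ofFinite A; inferInstance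
  Γk₀Fin := Fintype.ofFinite A
  m
    | none => .load (fun _ => ((none, none), tm.initialState)) .halt
    | some l => relabel some (some none) (M.m l)

theorem bank_nil : (fun _ => []) = bank (A := A) (tm := tm) [] [] (regs [] [] [] [])
    fun _ => [] := by
  funext k
  rcases k with _ | _ | r | k
  · rfl
  · rfl
  · cases r <;> rfl
  · rfl

-- The output convention requires all stacks except the output to be empty and the state to be the
-- initial one. Therefore `writeOutput` clears the register, and the additional label `none` of
-- `machine` resets the state at the cost of one step.
open Classical in
theorem inPTIME_of_polyFun [Finite A] {α : Type} (encode : α → List A) (p : α → Prop) (l : A)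
    (h : PolyFun tm (fun a => [(encode a).reverse]) fun a => boolWord l (decide (p a))) :
    InPTIME encode p := by
  obtain ⟨M, q, hM⟩ := h
  set P := (readInput A tm).seq (M.seq (writeOutput A tm)) with hP
  set t : Polynomial ℕ := .C 2 * .X + 2 + (q.comp (.X + 1) + (.C 2 * q.comp (.X + 1) + 2)) + 1
    with ht
  have hout : ∀ a, ∃ n ≤ t.eval (encode a).length, Steps (machine P).m n
      (initList (machine P) (encode a)) (haltList (machine P) [decide (p a)]) := by
    intro a
    have h1 := readInput_sends (tm := tm) (encode a)
    have h2 := (hM a).2 []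
    have h3 := writeOutput_sends (tm := tm) l (decide (p a)) [(encode a).reverse]
    obtain ⟨v', n, hn, hs⟩ := Frag.seq_sends h1 (Frag.seq_sends h2 h3)
      ((none, none), tm.initialState)
    have hs' := hs.relabel (m' := (machine P).m) (f := some) (e := some none) fun _ => rfl
    refine ⟨n + 1, ?_, ?_⟩
    · have h4 := (hM a).1
      have h5 : size [(encode a).reverse] = (encode a).length + 1 := by simp
      simp only [h5] at hn h4
      simp only [ht, Polynomial.eval_add, Polynomial.eval_mul, Polynomial.eval_C,
        Polynomial.eval_X, Polynomial.eval_comp, Polynomial.eval_one, Polynomial.eval_ofNat]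
      omega
    · have e1 : initList (machine P) (encode a) = relabelCfg some (some none)
          ⟨some P.entry, ((none, none), tm.initialState),
            bank (encode a) [] (regs [] [] [] []) fun _ => []⟩ := by
        have : (initList (machine P) (encode a)).stk =
            bank (encode a) [] (regs [] [] [] []) fun _ => [] := by
          exact (initList_stk (tm := machine P) (encode a)).trans <|
            (congrArg (Function.update · _ _) bank_nil).trans
              (update_bank_input _ _ _ _ _)
        rw [← this]
        rfl
      have e2 : haltList (machine P) [decide (p a)] =
          TM2.stepAux ((machine P).m none) v'
            (bank [] [decide (p a)] (regs [] [] [] []) fun _ => []) := by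
        have : (haltList (machine P) [decide (p a)]).stk =
            bank [] [decide (p a)] (regs [] [] [] []) fun _ => [] := by
          exact (haltList_stk (tm := machine P) _).trans <|
            (congrArg (Function.update · _ _) bank_nil).trans
              (update_bank_output _ _ _ _ _)
        rw [← this]
        rfl
      rw [e1]
      refine hs'.trans (.head ?_)
      rw [e2]
      exact .refl _
  choose n hn hs using hout
  exact ⟨{
    tm := machine P
    inputAlphabet := Equiv.refl A
    outputAlphabet := Equiv.refl Bool
    time := t
    outputsFun := fun a =>
      { steps := n a
        evals_in_steps := by
          have := (hs a).iterate
          rwa [← List.map_id (encode a)] at this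
        steps_le_m := hn a } }⟩

end Complete

end

section

/-! ### Truth of sentences -/

section Truth

variable {S : Schema} {𝒰 : Type}

/-- The value of a term. -/
def termVal {n : ℕ} : (lang S 𝒰).Term (Empty ⊕ Fin n) → (Fin n → 𝒰) → 𝒰
  | .var (.inr i), v => v i
  | .func (.const c) _, _ => c

variable [LinearOrder 𝒰]

theorem realize_eq_termVal (D : Instance S 𝒰) {n : ℕ} (t : (lang S 𝒰).Term (Empty ⊕ Fin n))
    (v : Fin n → 𝒰) :
    (letI := toStructure D; t.realize (Sum.elim Empty.elim v)) = termVal t v := by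
  match t with
  | .var (.inr i) => rfl
  | .func (.const c) _ => rfl

theorem naturalTrue_iff (D : Instance S 𝒰) (φ : (lang S 𝒰).Sentence) :
    NaturalTrue D φ ↔ RealizeOn D Set.univ φ Fin.elim0 := by
  let := toStructure D
  have key : ∀ {n : ℕ} (φ : (lang S 𝒰).BoundedFormula Empty n) (v : Fin n → 𝒰),
      φ.Realize Empty.elim v ↔ RealizeOn D Set.univ φ v := by
    intro n φ
    induction φ with
    | falsum => exact fun v => Iff.rfl
    | equal s t => exact fun v => Iff.rfl
    | rel R ts => exact fun v => Iff.rfl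
    | imp φ ψ h₁ h₂ => exact fun v => imp_congr (h₁ v) (h₂ v)
    | all φ h => exact fun v => forall_congr' fun x => by simp [h]
  rw [← key, NaturalTrue, Language.Sentence.Realize, Language.Formula.Realize,
    Subsingleton.elim (default : Empty → 𝒰) Empty.elim,
    Subsingleton.elim (default : Fin 0 → 𝒰) Fin.elim0]

/-- The quantifier ranges compared are all of `𝒰` and the active domain itself. -/
theorem DomainIndependent.naturalTrue_iff {φ : (lang S 𝒰).Sentence} (h : DomainIndependent φ)
    (D : Instance S 𝒰) : NaturalTrue D φ ↔ ActiveTrue D φ :=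
  (IncCQA.naturalTrue_iff D φ).trans (h D _ _ (Set.subset_univ _) subset_rfl)

theorem realizeOn_alls (D : Instance S 𝒰) (E : Set 𝒰) {n : ℕ}
    (φ : (lang S 𝒰).BoundedFormula Empty n) :
    RealizeOn D E φ.alls Fin.elim0 ↔ ∀ v : Fin n → 𝒰, (∀ i, v i ∈ E) → RealizeOn D E φ v := by
  induction n with
  | zero =>
    refine ⟨fun h v _ => ?_, fun h => h _ fun i => i.elim0⟩
    rwa [Subsingleton.elim v Fin.elim0]
  | succ n ih =>
    refine (ih φ.all).trans ⟨fun h v hv => ?_, fun h v hv x hx => h _ fun i => ?_⟩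
    · have := h (Fin.init v) (fun i => hv _) (v (Fin.last n)) (hv _)
      rwa [Fin.snoc_init_self] at this
    · refine Fin.lastCases ?_ (fun i => ?_) i
      · simpa using hx
      · simpa using hv i

theorem realizeOn_foldr_inf (D : Instance S 𝒰) (E : Set 𝒰) {n : ℕ} (v : Fin n → 𝒰)
    (l : List ((lang S 𝒰).BoundedFormula Empty n)) :
    RealizeOn D E (l.foldr (· ⊓ ·) ⊤) v ↔ ∀ φ ∈ l, RealizeOn D E φ v := by
  induction l with
  | nil => exact iff_of_true id (by simp)
  | cons φ l ih =>
    rw [List.forall_mem_cons, ← ih]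
    change ((RealizeOn D E φ v → RealizeOn D E _ v → False) → False) ↔ _
    tauto

/-- A smaller instance has a smaller active domain and fewer true database atoms, and comparisons do
not depend on the instance; so a violating assignment for `D'` violates the constraint in `D` as
well. -/
theorem DenialConstraint.activeTrue_anti {D D' : Instance S 𝒰} (h : D' ⊆ D)
    (κ : DenialConstraint S 𝒰) (hD : ActiveTrue D κ.toSentence) :
    ActiveTrue D' κ.toSentence := by
  have hsub : activeDomain D' κ.toSentence ⊆ activeDomain D κ.toSentence :=
    Set.union_subset_union_left _ fun c ⟨f, hf, hc⟩ => ⟨f, h hf, hc⟩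
  unfold ActiveTrue DenialConstraint.toSentence at *
  rw [realizeOn_alls] at *
  intro v hv hbody
  refine hD v (fun i => hsub (hv i)) ?_
  rw [realizeOn_foldr_inf] at *
  intro φ hφ
  have := hbody φ hφ
  rcases List.mem_append.mp hφ with hφ | hφ
  · obtain ⟨A, -, rfl⟩ := List.mem_map.mp hφ
    simp only [dbAtom, RealizeOn, realize_eq_termVal] at this ⊢
    exact h this
  · obtain ⟨C, -, rfl⟩ := List.mem_map.mp hφ
    simp only [cmpAtom, RealizeOn, realize_eq_termVal] at this ⊢
    exact this

theorem Consistent.anti {IC : List (DenialConstraint S 𝒰)} {D D' : Instance S 𝒰} (h : D' ⊆ D)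
    (hD : Consistent ActiveTrue IC D) : Consistent ActiveTrue IC D' :=
  fun κ hκ => κ.activeTrue_anti h (hD κ hκ)

theorem incrementalCQA_natural_iff {IC : List (DenialConstraint S 𝒰)} {Q : (lang S 𝒰).Sentence}
    (hIC : ∀ κ ∈ IC, DomainIndependent κ.toSentence) (hQ : DomainIndependent Q) (m : ℕ)
    (x : Input S 𝒰) :
    IncrementalCQA NaturalTrue IC Q m x ↔ IncrementalCQA ActiveTrue IC Q m x := by
  have h1 : ∀ D, Consistent NaturalTrue IC D ↔ Consistent ActiveTrue IC D := fun D =>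
    forall₂_congr fun κ hκ => (hIC κ hκ).naturalTrue_iff D
  simp only [IncrementalCQA, CertainlyTrue, IsCRepair, IsRepair, h1, hQ.naturalTrue_iff]

end Truth

/-! ### Repairs of an updated instance -/

section Repairs

variable {S : Schema} {𝒰 : Type}

-- Each operation adds at most one fact, a change included: its other effect is a deletion.
open Classical in
theorem card_applyUpdates_sdiff (U : List (Update S 𝒰)) (D : Instance S 𝒰) :
    (applyUpdates U D \ D).card ≤ U.length := by
  have hstep : ∀ (u : Update S 𝒰) (D' : Instance S 𝒰), ∃ f, Update.apply D' u ⊆ insert f D' := by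
    rintro (f | f | ⟨f, i, c⟩) D'
    · exact ⟨f, subset_rfl⟩
    · exact ⟨f, (Finset.erase_subset _ _).trans (Finset.subset_insert _ _)⟩
    · simp only [Update.apply]
      split
      · exact ⟨_, Finset.insert_subset_insert _ (Finset.erase_subset _ _)⟩
      · exact ⟨f, Finset.subset_insert _ _⟩
  have key : ∀ (U : List (Update S 𝒰)) (D' : Instance S 𝒰),
      (U.foldl Update.apply D' \ D).card ≤ (D' \ D).card + U.length := by
    intro U
    induction U with
    | nil => simp
    | cons u U ih =>
      intro D'
      obtain ⟨f, hf⟩ := hstep u D'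
      have h1 : (Update.apply D' u \ D).card ≤ (D' \ D).card + 1 := by
        refine (Finset.card_le_card (t := insert f (D' \ D)) fun c hc => ?_).trans
          (Finset.card_insert_le _ _)
        have := hf (Finset.mem_sdiff.mp hc).1
        simp only [Finset.mem_insert, Finset.mem_sdiff] at this hc ⊢
        tauto
      have := ih (Update.apply D' u)
      simp only [List.foldl_cons, List.length_cons]
      omega
  simpa [applyUpdates] using key U D

/-- `P` holds after the deletion of exactly `k` suitable facts. -/
def AfterDeletion {F : Type} [DecidableEq F] (P : Finset F → Prop) : ℕ → List F → Prop
  | 0, L => P L.toFinset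
  | k + 1, L => ∃ d ∈ L, AfterDeletion P k (L.filter fun f => f ≠ d)

/-- Filtering removes every copy of the chosen fact, so later choices differ from it and `k` rounds
delete `k` distinct facts. The recursive form can be run as nested loops. -/
theorem afterDeletion_iff {F : Type} [DecidableEq F] (P : Finset F → Prop) (k : ℕ) (L : List F) :
    AfterDeletion P k L ↔ ∃ T ⊆ L.toFinset, T.card = k ∧ P (L.toFinset \ T) := by
  induction k generalizing L with
  | zero =>
    refine ⟨fun h => ⟨∅, by simp, rfl, by simpa [AfterDeletion] using h⟩, ?_⟩
    rintro ⟨T, -, hT, h⟩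
    rw [Finset.card_eq_zero] at hT
    subst hT
    simpa [AfterDeletion] using h
  | succ k ih =>
    have hfil : ∀ d, (L.filter fun f => f ≠ d).toFinset = L.toFinset.erase d := fun d => by
      ext f; simp [and_comm]
    simp only [AfterDeletion, ih, hfil]
    constructor
    · rintro ⟨d, hd, T, hT, rfl, h⟩
      have hdT : d ∉ T := fun h => by simpa using hT h
      refine ⟨insert d T, ?_, Finset.card_insert_of_notMem hdT, ?_⟩
      · exact Finset.insert_subset (by simpa using hd) (hT.trans (Finset.erase_subset _ _))
      · rwa [Finset.sdiff_insert, ← Finset.erase_sdiff_comm]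
    · rintro ⟨T, hT, hk, h⟩
      obtain ⟨d, hd⟩ : T.Nonempty := Finset.card_pos.mp (by omega)
      refine ⟨d, by simpa using hT hd, T.erase d, Finset.erase_subset_erase _ hT, ?_, ?_⟩
      · rw [Finset.card_erase_of_mem hd]; omega
      · convert h using 1
        ext f
        simp only [Finset.mem_sdiff, Finset.mem_erase]
        constructor
        · rintro ⟨⟨h1, h2⟩, h3⟩
          exact ⟨h2, fun h4 => h3 ⟨h1, h4⟩⟩
        · rintro ⟨h1, h2⟩
          exact ⟨⟨fun h3 => h2 (h3 ▸ hd), h1⟩, fun h3 => h2 h3.2⟩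

/-- For any `D'` with `P`, the set `D ∩ D' = D \ (D \ D')` also has `P` and is closer to `D` by `|D'
\ D|`. Minimal sets thus arise by deletions only, and `hm` bounds their number by `m`. On the right,
the first alternative says that `k` is not the minimal number, the second that no `k` deletions give
a counterexample to `Q`. -/
theorem forall_minimal_iff {F : Type} [DecidableEq F] {P Q : Finset F → Prop}
    (hP : ∀ {D D' : Finset F}, D' ⊆ D → P D → P D') {D : Finset F} {m : ℕ}
    (hm : ∃ T ⊆ D, T.card ≤ m ∧ P (D \ T)) :
    (∀ D', P D' → (∀ D'', P D'' → (symmDiff D' D).card ≤ (symmDiff D'' D).card) → Q D') ↔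
      ∀ k ≤ m, (∃ j < k, ∃ T ⊆ D, T.card = j ∧ P (D \ T)) ∨
        ¬ ∃ T ⊆ D, T.card = k ∧ P (D \ T) ∧ ¬ Q (D \ T) := by
  have hdist : ∀ T ⊆ D, (symmDiff (D \ T) D).card = T.card := by
    intro T hT
    congr 1
    ext f
    have := @hT f
    simp only [Finset.mem_symmDiff, Finset.mem_sdiff]
    tauto
  have hcap : ∀ D' : Finset F, D \ (D \ D') = D ∩ D' := fun D' => by
    ext f
    simp only [Finset.mem_sdiff, Finset.mem_inter]
    tauto
  have hle : ∀ D' : Finset F, (symmDiff D' D).card = (D' \ D).card + (D \ D').card := by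
    intro D'
    rw [symmDiff_def, Finset.sup_eq_union, Finset.card_union_of_disjoint]
    exact disjoint_sdiff_sdiff
  constructor
  · intro h k hk
    by_contra! hcon
    obtain ⟨hj, T, hT, rfl, hc, hQ⟩ := hcon
    refine hQ (h _ hc fun D'' hc'' => ?_)
    rw [hdist T hT]
    by_contra! hlt
    rw [hle] at hlt
    -- A closer `D''` would give `D ∩ D''`, obtained from `D` by fewer than `|T|` deletions.
    refine hj (D \ D'').card (by omega) (D \ D'') Finset.sdiff_subset rfl ?_
    rw [hcap]
    exact hP Finset.inter_subset_right hc''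
  · intro h D' hc hmin
    have hcT : P (D \ (D \ D')) := by
      rw [hcap]
      exact hP Finset.inter_subset_right hc
    have h1 := hmin _ hcT
    rw [hdist _ Finset.sdiff_subset, hle] at h1
    -- Minimality of `D'` against `D ∩ D'` leaves no room for facts outside `D`.
    have hsub : D' ⊆ D := by
      rw [← Finset.sdiff_eq_empty_iff_subset, ← Finset.card_eq_zero]
      omega
    have hD'eq : D \ (D \ D') = D' := by
      rw [hcap]
      exact Finset.inter_eq_right.mpr hsub
    obtain ⟨T, hT, hTm, hTc⟩ := hm
    have h2 := hmin _ hTc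
    rw [hdist T hT, hle] at h2
    by_contra hQ
    rcases h (D \ D').card (by omega) with ⟨j, hj, T', hT', rfl, hT'c⟩ | h3
    · have := hmin _ hT'c
      rw [hdist T' hT', hle] at this
      omega
    · exact h3 ⟨D \ D', Finset.sdiff_subset, rfl, hcT, by rwa [hD'eq]⟩

variable [LinearOrder 𝒰]

/-- Cardinalities are linearly ordered, so having no strictly preferred competitor means having
minimal distance. The equality test is arbitrary here, whereas `cardPref` uses the classical one. -/
theorem certainlyTrue_iff [inst : DecidableEq (Fact S 𝒰)] (IC : List (DenialConstraint S 𝒰))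
    (Q : (lang S 𝒰).Sentence) (D : Instance S 𝒰) :
    CertainlyTrue ActiveTrue IC Q D ↔ ∀ D', Consistent ActiveTrue IC D' →
      (∀ D'', Consistent ActiveTrue IC D'' → (symmDiff D' D).card ≤ (symmDiff D'' D).card) →
        ActiveTrue D' Q := by
  have hpref : ∀ D' D'', cardPref D D' D'' ↔ (symmDiff D' D).card ≤ (symmDiff D'' D).card := by
    intro D' D''
    unfold cardPref
    congr!
  refine forall_congr' fun D' => ?_
  rw [IsCRepair, IsRepair, and_imp]
  refine imp_congr_right fun _ => imp_congr_left ?_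
  simp only [hpref, not_exists, not_and, not_not]
  refine forall₂_congr fun D'' _ => ⟨fun h => ?_, fun h _ => h⟩
  by_contra hlt
  exact hlt (h (by omega))

theorem incrementalCQA_iff [inst : DecidableEq (Fact S 𝒰)] (IC : List (DenialConstraint S 𝒰))
    (Q : (lang S 𝒰).Sentence) (m : ℕ) (x : Input S 𝒰) (L : List (Fact S 𝒰))
    (hL : L.toFinset = applyUpdates x.2 x.1.toFinset) :
    IncrementalCQA ActiveTrue IC Q m x ↔ Consistent ActiveTrue IC x.1.toFinset ∧ x.2.length = m ∧
      ∀ k ≤ m, (∃ j < k, AfterDeletion (Consistent ActiveTrue IC) j L) ∨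
        ¬ AfterDeletion (fun D => Consistent ActiveTrue IC D ∧ ¬ ActiveTrue D Q) k L := by
  have hx : ∀ i, @List.toFinset _ i x.1 = x.1.toFinset := fun i => by
    rw [Subsingleton.elim i inst]
  unfold IncrementalCQA
  simp only [hx, afterDeletion_iff, hL]
  refine and_congr_right fun hc => and_congr_right fun hm =>
    (certainlyTrue_iff IC Q _).trans (forall_minimal_iff Consistent.anti ?_)
  -- Deleting from `U(D)` the facts that were not in `D` leaves a subset of the consistent instance
  -- `D`.
  refine ⟨applyUpdates x.2 x.1.toFinset \ x.1.toFinset, Finset.sdiff_subset, ?_, ?_⟩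
  · rw [← hm]
    convert card_applyUpdates_sdiff x.2 x.1.toFinset
  · refine hc.anti fun f hf => ?_
    simp only [Finset.mem_sdiff, not_and, not_not] at hf
    exact hf.2 hf.1

end Repairs

end

section

/-! ### Polynomial-time predicates of a stack of words -/

section Predicates

variable {S : Schema} {tm : FinTM2} {α β γ : Type}

open Classical in
/-- The predicate `p` can be decided in polynomial time from the stack `g a`. -/
def PolyPred (tm : FinTM2) (g : α → List (List (Letter S))) (p : α → Prop) : Prop :=
  PolyFun tm g fun a => boolWord Letter.sep (decide (p a))

/-- Weakening below the top word. It hides the remaining list and the accumulator of a loop from a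
body that needs only the current item. -/
theorem PolyFun.exchange {A : Type} {g : α → List (List A)} {x z : α → List A}
    (h : PolyFun tm (fun a => x a :: g a) z) (y : α → List A) :
    PolyFun tm (fun a => x a :: y a :: g a) z :=
  (PolyTrans.swap _ _ _).trans ((PolyTrans.weaken h y).trans
    ((PolyTrans.swap _ _ _).trans ((PolyTrans.swap _ _ _).weaken _)))

theorem head?_boolWord {A : Type} (l : A) (b : Bool) : (boolWord l b).head?.isSome = b := by
  cases b <;> rfl

variable {g : α → List (List (Letter S))} {p q : α → Prop}

theorem PolyPred.congr (h : PolyPred tm g p) (hpq : ∀ a, p a ↔ q a) : PolyPred tm g q := by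
  obtain rfl : p = q := funext fun a => propext (hpq a)
  exact h

theorem PolyPred.const (P : Prop) : PolyPred tm g fun _ => P := PolyFun.const _

theorem PolyPred.not (h : PolyPred tm g p) : PolyPred tm g fun a => ¬ p a := by
  classical
  have := PolyFun.headTest Letter.sep (fun c => !c.isSome) h
  simp only [head?_boolWord] at this
  simpa [PolyPred] using this

theorem PolyPred.ite {x y : α → List (Letter S)} (h : PolyPred tm g p) (hx : PolyFun tm g x)
    (hy : PolyFun tm g y) (hp : ∀ a, Decidable (p a)) :
    PolyFun tm g fun a => if p a then x a else y a := by
  have := PolyFun.ite_head Option.isSome h hx hy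
  simp only [head?_boolWord, decide_eq_true_eq] at this
  convert this

theorem PolyPred.and (hp : PolyPred tm g p) (hq : PolyPred tm g q) :
    PolyPred tm g fun a => p a ∧ q a := by
  classical
  have := hp.ite hq (.const []) (fun _ => inferInstance)
  unfold PolyPred
  convert this using 2 with a
  by_cases h : p a <;> simp [h, boolWord]

theorem PolyPred.or (hp : PolyPred tm g p) (hq : PolyPred tm g q) :
    PolyPred tm g fun a => p a ∨ q a :=
  (hp.not.and hq.not).not.congr fun a => by tauto

theorem PolyPred.imp (hp : PolyPred tm g p) (hq : PolyPred tm g q) :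
    PolyPred tm g fun a => p a → q a :=
  (hp.and hq.not).not.congr fun a => by tauto

/-- Here `n` is a constant: the programs for the single `k` are joined, and they need not be uniform
in `k`. -/
theorem PolyPred.forall_lt {P : ℕ → α → Prop} (h : ∀ k, PolyPred tm g (P k)) (n : ℕ) :
    PolyPred tm g fun a => ∀ k < n, P k a := by
  induction n with
  | zero => exact (PolyPred.const True).congr fun a => by simp
  | succ n ih => exact (ih.and (h n)).congr fun a => Nat.forall_lt_succ_right.symm

theorem PolyPred.exists_lt {P : ℕ → α → Prop} (h : ∀ k, PolyPred tm g (P k)) (n : ℕ) :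
    PolyPred tm g fun a => ∃ k < n, P k a :=
  (PolyPred.forall_lt (fun k => (h k).not) n).not.congr fun a => by push Not; rfl

theorem PolyFun.eqPred {x y : α → List (Letter S)} (hx : PolyFun tm g x) (hy : PolyFun tm g y) :
    PolyPred tm g fun a => x a = y a := by
  unfold PolyPred
  convert PolyFun.eq Letter.sep hx hy

theorem PolyFun.headPred {x : α → List (Letter S)} (hx : PolyFun tm g x)
    (P : Option (Letter S) → Prop) : PolyPred tm g fun a => P (x a).head? := by
  classical
  exact PolyFun.headTest Letter.sep (fun c => decide (P c)) hx

/-- The words `code b` end with a letter of the kind `e`, and have no other such letter. -/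
def EndsWith (e : Letter S → Bool) (code : β → List (Letter S)) : Prop :=
  ∀ b, ∃ w c, code b = w ++ [c] ∧ (∀ d ∈ w, e d = false) ∧ e c = true

variable {e : Letter S → Bool} {code : β → List (Letter S)} {L : α → List β}

/-- A search is a fold with a Boolean accumulator, whose word has length at most 1. -/
theorem PolyPred.exists_mem (hcode : EndsWith e code) {p : α → β → Prop}
    (hL : PolyFun tm g fun a => (L a).flatMap code)
    (hp : PolyPred tm (fun q : α × β => code q.2 :: g q.1) fun q => p q.1 q.2) :
    PolyPred tm g fun a => ∃ b ∈ L a, p a b := by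
  classical
  have hbody : PolyFun tm (fun q : α × β × List β × Bool =>
      code q.2.1 :: q.2.2.1.flatMap code :: boolWord Letter.sep q.2.2.2 :: g q.1)
      (fun q => boolWord Letter.sep (q.2.2.2 || decide (p q.1 q.2.1))) := by
    have h1 : PolyPred tm (fun q : α × β × List β × Bool =>
        code q.2.1 :: q.2.2.1.flatMap code :: boolWord Letter.sep q.2.2.2 :: g q.1)
        (fun q => p q.1 q.2.1) :=
      ((PolyFun.comap hp fun q : α × β × List β × Bool => (q.1, q.2.1)).exchange _).exchange _
    have h2 : PolyPred tm (fun q : α × β × List β × Bool =>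
        code q.2.1 :: q.2.2.1.flatMap code :: boolWord Letter.sep q.2.2.2 :: g q.1)
        (fun q => q.2.2.2 = true) := by
      unfold PolyPred
      simp only [Bool.decide_eq_true]
      exact (PolyFun.top.weaken _).weaken _
    have := h2.or h1
    unfold PolyPred at this
    convert this using 3
    simp
  have := PolyFun.fold e code hcode (boolWord Letter.sep) (L := L) (init := fun _ => false)
    (step := fun a b c => c || decide (p a b)) hL (.const []) hbody 1 fun a l₁ l₂ _ => by
      unfold boolWord
      split <;> simp
  unfold PolyPred
  convert this using 3 with a
  have key : ∀ (l : List β) (c : Bool),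
      l.foldl (fun c b => c || decide (p a b)) c = (c || decide (∃ b ∈ l, p a b)) := by
    intro l
    induction l with
    | nil => simp
    | cons b l ih =>
      intro c
      rw [List.foldl_cons, ih]
      simp [Bool.or_assoc]
  simp [key]

theorem PolyPred.forall_mem (hcode : EndsWith e code) {p : α → β → Prop}
    (hL : PolyFun tm g fun a => (L a).flatMap code)
    (hp : PolyPred tm (fun q : α × β => code q.2 :: g q.1) fun q => p q.1 q.2) :
    PolyPred tm g fun a => ∀ b ∈ L a, p a b :=
  (PolyPred.exists_mem (p := fun a b => ¬ p a b) hcode hL hp.not).not.congr fun a => by simp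

theorem PolyFun.filter (hcode : EndsWith e code) {p : α → β → Prop}
    (hp' : ∀ a b, Decidable (p a b)) (hL : PolyFun tm g fun a => (L a).flatMap code)
    (hp : PolyPred tm (fun q : α × β => code q.2 :: g q.1) fun q => p q.1 q.2) :
    PolyFun tm g fun a => ((L a).filter fun b => p a b).flatMap code := by
  have key : ∀ (a : α) (l c : List β),
      l.foldl (fun c b => c ++ if p a b then [b] else []) c = c ++ l.filter fun b => p a b := by
    intro a l
    induction l with
    | nil => simp
    | cons b l ih =>
      intro c
      rw [List.foldl_cons, ih]
      by_cases h : p a b <;> simp [h]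
  have hbody : PolyFun tm (fun q : α × β × List β × List β =>
      code q.2.1 :: q.2.2.1.flatMap code :: q.2.2.2.flatMap code :: g q.1)
      (fun q => (q.2.2.2 ++ if p q.1 q.2.1 then [q.2.1] else []).flatMap code) := by
    have h1 : PolyPred tm (fun q : α × β × List β × List β =>
        code q.2.1 :: q.2.2.1.flatMap code :: q.2.2.2.flatMap code :: g q.1)
        (fun q => p q.1 q.2.1) :=
      ((PolyFun.comap hp fun q : α × β × List β × List β => (q.1, q.2.1)).exchange _).exchange _
    have h2 := ((PolyFun.top.weaken _).weaken _).append
      (h1.ite PolyFun.top (.const []) fun q => hp' _ _)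
    convert h2 using 2 with q
    by_cases h : p q.1 q.2.1 <;> simp [h]
  have := PolyFun.fold e code hcode (fun c : List β => c.flatMap code) (L := L)
    (init := fun _ => []) (step := fun a b c => c ++ if p a b then [b] else []) hL (.const [])
    hbody .X fun a l₁ l₂ h => by
      rw [key, h]
      have h1 : ((l₁.filter fun b => p a b).flatMap code).length ≤ (l₁.flatMap code).length :=
        (List.filter_sublist.flatMap code).length_le
      simp only [List.nil_append, List.flatMap_append, size_cons, List.length_append,
        Polynomial.eval_X]
      omega
  simpa [key] using this

theorem PolyFun.reverseList (hcode : EndsWith e code)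
    (hL : PolyFun tm g fun a => (L a).flatMap code) :
    PolyFun tm g fun a => (L a).reverse.flatMap code := by
  have key : ∀ l c : List β, l.foldl (fun c b => b :: c) c = l.reverse ++ c := by
    intro l
    induction l with
    | nil => simp
    | cons b l ih => intro c; simp [ih]
  have hbody : PolyFun tm (fun q : α × β × List β × List β =>
      code q.2.1 :: q.2.2.1.flatMap code :: q.2.2.2.flatMap code :: g q.1)
      (fun q => (q.2.1 :: q.2.2.2).flatMap code) := by
    simp only [List.flatMap_cons]
    exact PolyFun.top.append ((PolyFun.top.weaken _).weaken _)
  have := PolyFun.fold e code hcode (fun c : List β => c.flatMap code) (L := L)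
    (init := fun _ => []) (step := fun _ b c => b :: c) hL (.const [])
    hbody .X fun a l₁ l₂ h => by
      rw [key, h]
      simp only [List.append_nil, List.flatMap_append, size_cons, List.length_append,
        Polynomial.eval_X, List.length_flatMap, List.map_reverse, List.sum_reverse]
      omega
  simpa [key] using this

/-- The items are counted in unary, and the counter is compared with the constant word for `m`. -/
theorem PolyPred.length_eq (hcode : EndsWith e code)
    (hL : PolyFun tm g fun a => (L a).flatMap code) (m : ℕ) :
    PolyPred tm g fun a => (L a).length = m := by
  have key : ∀ (l : List β) (n : ℕ), l.foldl (fun c _ => c + 1) n = n + l.length := by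
    intro l
    induction l with
    | nil => simp
    | cons b l ih => intro c; simp [ih]; omega
  have hpos : ∀ l : List β, l.length ≤ (l.flatMap code).length := by
    intro l
    induction l with
    | nil => simp
    | cons b l ih =>
      obtain ⟨w, c, hb, -, -⟩ := hcode b
      simp only [List.length_cons, List.flatMap_cons, List.length_append, hb, List.length_nil]
      omega
  have hbody : PolyFun tm (fun q : α × β × List β × ℕ =>
      code q.2.1 :: q.2.2.1.flatMap code :: List.replicate q.2.2.2 Letter.sep :: g q.1)
      (fun q => List.replicate (q.2.2.2 + 1) Letter.sep) :=
    (PolyFun.const [Letter.sep]).append ((PolyFun.top.weaken _).weaken _)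
  have := PolyFun.fold e code hcode (fun n : ℕ => List.replicate n (Letter.sep (S := S))) (L := L)
    (init := fun _ => 0) (step := fun _ _ c => c + 1) hL (.const [])
    hbody .X fun a l₁ l₂ h => by
      have := hpos l₁
      rw [key, h]
      simp only [List.flatMap_append, size_cons, List.length_append, Polynomial.eval_X,
        List.length_replicate, zero_add]
      omega
  exact (this.eqPred (.const (List.replicate m Letter.sep))).congr fun a => by
    rw [key, List.replicate_left_inj, zero_add]

theorem PolyFun.flatten_ofFn {n : ℕ} {X : Fin n → α → List (Letter S)}
    (h : ∀ i, PolyFun tm g (X i)) :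
    PolyFun tm g fun a => (List.ofFn fun i => X i a).flatten := by
  induction n with
  | zero => simpa using PolyFun.const (tm := tm) (g := g) []
  | succ n ih => simpa [List.ofFn_succ] using (h 0).append (ih fun i => h i.succ)

end Predicates

end

section

/-! ### Words for constants and facts -/

section Codes

variable {S : Schema} {𝒰 : Type} {enc : 𝒰 → List Bool}

instance (S : Schema) : Finite (Letter S) := by
  have := S.finite_rel
  refine Finite.of_surjective (fun x : Option Bool ⊕ S.Rel ⊕ S.Rel ⊕ S.Rel ⊕
    (Σ r : S.Rel, Fin (S.arity r)) => (match x with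
      | .inl none => Letter.sep
      | .inl (some b) => .bit b
      | .inr (.inl r) => .fact r
      | .inr (.inr (.inl r)) => .insert r
      | .inr (.inr (.inr (.inl r))) => .delete r
      | .inr (.inr (.inr (.inr ⟨r, A⟩))) => .change r A : Letter S)) fun l => ?_
  cases l with
  | bit b => exact ⟨.inl (some b), rfl⟩
  | sep => exact ⟨.inl none, rfl⟩
  | fact r => exact ⟨.inr (.inl r), rfl⟩
  | insert r => exact ⟨.inr (.inr (.inl r)), rfl⟩
  | delete r => exact ⟨.inr (.inr (.inr (.inl r))), rfl⟩
  | change r A => exact ⟨.inr (.inr (.inr (.inr ⟨r, A⟩))), rfl⟩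

/-- The letter closes a constant. -/
def isSep : Letter S → Bool
  | .sep => true
  | _ => false

/-- The letter opens a ground atom or an update operation. -/
def isHeader : Letter S → Bool
  | .bit _ => false
  | .sep => false
  | _ => true

/-- A ground atom as a word that ends with the relation name. -/
def codeFact (enc : 𝒰 → List Bool) (f : Fact S 𝒰) : List (Letter S) := (encodeFact enc f).reverse

/-- An update operation as a word that ends with its header. -/
def codeUpdate (enc : 𝒰 → List Bool) (u : Update S 𝒰) : List (Letter S) :=
  (encodeUpdate enc u).reverse

theorem endsWith_encodeConst : EndsWith isSep (encodeConst S enc) := fun c =>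
  ⟨(enc c).map .bit, .sep, rfl, fun _ h => by obtain ⟨b, -, rfl⟩ := List.mem_map.mp h; rfl, rfl⟩

theorem isHeader_encodeConst {c : 𝒰} {l : Letter S} (h : l ∈ encodeConst S enc c) :
    isHeader l = false := by
  rcases List.mem_append.mp h with h | h
  · obtain ⟨b, -, rfl⟩ := List.mem_map.mp h
    rfl
  · rw [List.mem_singleton.mp h]
    rfl

theorem isHeader_encodeTuple {k : ℕ} {t : Fin k → 𝒰} {l : Letter S}
    (h : l ∈ encodeTuple S enc t) : isHeader l = false :=
  let ⟨_, _, h⟩ := List.mem_flatMap.mp h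
  isHeader_encodeConst h

theorem endsWith_codeFact : EndsWith isHeader (codeFact (S := S) enc) := fun f =>
  ⟨(encodeTuple S enc f.2).reverse, .fact f.1, by simp [codeFact, encodeFact],
    fun _ h => isHeader_encodeTuple (List.mem_reverse.mp h), rfl⟩

theorem endsWith_codeUpdate : EndsWith isHeader (codeUpdate (S := S) enc) := by
  rintro (f | f | ⟨f, A, a⟩)
  · exact ⟨(encodeTuple S enc f.2).reverse, .insert f.1, by simp [codeUpdate, encodeUpdate],
      fun _ h => isHeader_encodeTuple (List.mem_reverse.mp h), rfl⟩
  · exact ⟨(encodeTuple S enc f.2).reverse, .delete f.1, by simp [codeUpdate, encodeUpdate],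
      fun _ h => isHeader_encodeTuple (List.mem_reverse.mp h), rfl⟩
  · refine ⟨(encodeTuple S enc f.2 ++ encodeConst S enc a).reverse, .change f.1 A,
      by simp [codeUpdate, encodeUpdate], fun l h => ?_, rfl⟩
    rcases List.mem_append.mp (List.mem_reverse.mp h) with h | h
    · exact isHeader_encodeTuple h
    · exact isHeader_encodeConst h

theorem headItem_encodeConst (c : 𝒰) (w : List (Letter S)) :
    headItem isSep (encodeConst S enc c ++ w) = encodeConst S enc c ∧
      tailItem isSep (encodeConst S enc c ++ w) = w := by
  have h : ∀ l ∈ (enc c).map (Letter.bit (S := S)), (!isSep l) = true :=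
    fun _ h => by obtain ⟨b, -, rfl⟩ := List.mem_map.mp h; rfl
  rw [headItem, tailItem, encodeConst, List.append_assoc, List.takeWhile_append_of_pos h,
    List.dropWhile_append_of_pos h]
  simp [isSep]

theorem encodeConst_injective (henc : Function.Injective enc) :
    Function.Injective (encodeConst S enc) := fun a b h => by
  have := List.append_cancel_right h
  exact henc (List.map_injective_iff.mpr (fun x y h => by cases h; rfl) this)

/-- The separators make the code uniquely decodable: splitting at the first one recovers the first
constant. -/
theorem flatMap_encodeConst_injective (henc : Function.Injective enc) :
    Function.Injective fun l : List 𝒰 => l.flatMap (encodeConst S enc) := by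
  intro l
  induction l with
  | nil =>
    intro l' h
    cases l' with
    | nil => rfl
    | cons b l' => simp [encodeConst] at h
  | cons a l ih =>
    intro l' h
    cases l' with
    | nil => simp [encodeConst] at h
    | cons b l' =>
      simp only [List.flatMap_cons] at h
      have h1 := headItem_encodeConst (S := S) (enc := enc) a (l.flatMap (encodeConst S enc))
      rw [h, (headItem_encodeConst b _).1, (headItem_encodeConst b _).2] at h1
      rw [encodeConst_injective henc h1.1, ih h1.2.symm]

/-- The header fixes the relation name, and with it the type of the tuple. Equality of facts can
therefore be tested on words. -/
theorem codeFact_injective (henc : Function.Injective enc) :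
    Function.Injective (codeFact (S := S) enc) := by
  rintro ⟨r, t⟩ ⟨r', t'⟩ h
  have h1 := List.reverse_injective h
  simp only [encodeFact, List.cons.injEq, Letter.fact.injEq] at h1
  obtain ⟨rfl, h2⟩ := h1
  rw [List.ofFn_injective (flatMap_encodeConst_injective henc h2)]

theorem encodeTuple_eq {k : ℕ} (t : Fin k → 𝒰) :
    encodeTuple S enc t = (List.ofFn fun i => encodeConst S enc (t i)).flatten := by
  rw [encodeTuple, List.flatMap_def, List.map_ofFn]
  rfl

end Codes

/-! ### Evaluation of formulas in polynomial time -/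

section Evaluation

variable {S : Schema} {𝒰 : Type} {enc : 𝒰 → List Bool} {tm : FinTM2} {α : Type}
  {g : α → List (List (Letter S))}

theorem PolyFun.codeFact {r : S.Rel} {t : α → Fin (S.arity r) → 𝒰}
    (h : ∀ i, PolyFun tm g fun a => encodeConst S enc (t a i)) :
    PolyFun tm g fun a => codeFact enc ⟨r, t a⟩ := by
  have := ((PolyFun.const [Letter.fact r]).append (PolyFun.flatten_ofFn h)).reverse
  simpa [IncCQA.codeFact, encodeFact, encodeTuple_eq] using this

theorem PolyPred.mem (henc : Function.Injective enc) {D : α → List (Fact S 𝒰)}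
    {f : α → Fact S 𝒰} (hD : PolyFun tm g fun a => (D a).flatMap (codeFact enc))
    (hf : PolyFun tm g fun a => IncCQA.codeFact enc (f a)) :
    PolyPred tm g fun a => f a ∈ D a := by
  refine (PolyPred.exists_mem (p := fun a d => IncCQA.codeFact enc d = IncCQA.codeFact enc (f a))
    endsWith_codeFact hD (PolyFun.top.eqPred ?_)).congr fun a => ?_
  · exact (PolyFun.comap hf Prod.fst).weaken _
  · simp [(codeFact_injective henc).eq_iff]

theorem PolyFun.term {n : ℕ} {v : α → Fin n → 𝒰}
    (hv : ∀ i, PolyFun tm g fun a => encodeConst S enc (v a i))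
    (t : (lang S 𝒰).Term (Empty ⊕ Fin n)) :
    PolyFun tm g fun a => encodeConst S enc (termVal t (v a)) := by
  match t with
  | .var (.inr i) => exact hv i
  | .func (.const c) _ => exact PolyFun.const (encodeConst S enc c)

variable [LinearOrder 𝒰]

/-- The order of the constants can be decided by the machine `tm`. -/
def DecidesLT (S : Schema) (enc : 𝒰 → List Bool) (tm : FinTM2) : Prop :=
  ∀ (α : Type) (g : α → List (List (Letter S))) (x y : α → 𝒰),
    PolyFun tm g (fun a => encodeConst S enc (x a)) →
      PolyFun tm g (fun a => encodeConst S enc (y a)) → PolyPred tm g fun a => x a < y a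

theorem exists_decidesLT (S : Schema)
    (h : InPTIME (encodePair enc) fun p : 𝒰 × 𝒰 => p.1 < p.2) : ∃ tm, DecidesLT S enc tm := by
  classical
  obtain ⟨H⟩ := h
  refine ⟨H.tm, fun α g x y hx hy => ?_⟩
  have hbits : ∀ {x : α → 𝒰}, PolyFun H.tm g (fun a => encodeConst S enc (x a)) →
      PolyFun H.tm g fun a => (enc (x a)).map Letter.bit := by
    intro x hx
    -- The closing separator is the last letter; it is removed as the first letter of the reversed
    -- word.
    have := (hx.reverse.tailItem fun _ => true).reverse
    simpa [tailItem_true, encodeConst] using this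
  have := PolyTrans.embedded H Letter.sep (Letter.bit (S := S))
    (fun l => match l with | .bit b => b | _ => false) (fun _ => rfl) x y g
  have h2 := (hbits hy).trans (((hbits hx).weaken _).trans this)
  unfold PolyPred PolyFun
  convert h2

theorem PolyPred.comparison (henc : Function.Injective enc) (hlt : DecidesLT S enc tm)
    {x y : α → 𝒰} (hx : PolyFun tm g fun a => encodeConst S enc (x a))
    (hy : PolyFun tm g fun a => encodeConst S enc (y a)) (c : Comparison) :
    PolyPred tm g fun a => c.Holds (x a) (y a) := by
  have heq : PolyPred tm g fun a => x a = y a :=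
    (hx.eqPred hy).congr fun a => (encodeConst_injective henc).eq_iff
  cases c with
  | eq => exact heq
  | ne => exact heq.not
  | lt => exact hlt _ _ _ _ hx hy
  | le => exact (hlt _ _ _ _ hy hx).not.congr fun a => not_lt
  | gt => exact hlt _ _ _ _ hy hx
  | ge => exact (hlt _ _ _ _ hx hy).not.congr fun a => not_lt

/-- A quantifier becomes a loop over the list `E`, and the current value is pushed as the value of a
new variable. Since this extends the stack and the parameters, the induction is over all `α` and
`g`. -/
theorem PolyPred.realizeOn (henc : Function.Injective enc) (hlt : DecidesLT S enc tm) {n : ℕ}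
    (φ : (lang S 𝒰).BoundedFormula Empty n) :
    ∀ {α : Type} {g : α → List (List (Letter S))} {D : α → List (Fact S 𝒰)}
      {D' : α → Instance S 𝒰} {E : α → List 𝒰} {v : α → Fin n → 𝒰},
      (∀ a f, f ∈ D' a ↔ f ∈ D a) →
      PolyFun tm g (fun a => (D a).flatMap (IncCQA.codeFact enc)) →
      PolyFun tm g (fun a => (E a).flatMap (encodeConst S enc)) →
      (∀ i, PolyFun tm g fun a => encodeConst S enc (v a i)) →
      PolyPred tm g fun a => RealizeOn (D' a) {c | c ∈ E a} φ (v a) := by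
  induction φ with
  | falsum => exact fun _ _ _ _ => .const False
  | equal s t =>
    intro α g D D' E v _ _ _ hv
    simp only [RealizeOn, realize_eq_termVal]
    exact comparison henc hlt (PolyFun.term hv s) (PolyFun.term hv t) .eq
  | rel R ts =>
    intro α g D D' E v hD' hD _ hv
    simp only [RealizeOn, realize_eq_termVal]
    cases R with
    | db r =>
      exact (PolyPred.mem henc hD (PolyFun.codeFact fun i => PolyFun.term hv (ts i))).congr
        fun a => (hD' a _).symm
    | cmp c => exact comparison henc hlt (PolyFun.term hv (ts 0)) (PolyFun.term hv (ts 1)) c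
  | imp φ ψ h₁ h₂ => exact fun hD' hD hE hv => (h₁ hD' hD hE hv).imp (h₂ hD' hD hE hv)
  | all φ h =>
    intro α g D D' E v hD' hD hE hv
    refine PolyPred.forall_mem (p := fun a c => RealizeOn (D' a) {c | c ∈ E a} φ
      (Fin.snoc (v a) c)) endsWith_encodeConst hE ?_
    refine h (D := fun q => D q.1) (fun q f => hD' q.1 f) ((hD.comap Prod.fst).weaken _)
      ((hE.comap Prod.fst).weaken _) fun i => ?_
    refine Fin.lastCases ?_ (fun i => ?_) i
    · simpa using PolyFun.top
    · simpa using ((hv i).comap Prod.fst).weaken _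

omit [LinearOrder 𝒰] in
theorem finite_termConsts {β : Type} (t : (lang S 𝒰).Term β) : (termConsts t).Finite := by
  induction t with
  | var => exact Set.finite_empty
  | func f ts ih =>
    refine Set.Finite.union ?_ (Set.finite_iUnion ih)
    cases f
    exact Set.finite_singleton _

omit [LinearOrder 𝒰] in
theorem finite_formulaConsts {β : Type} {n : ℕ} (φ : (lang S 𝒰).BoundedFormula β n) :
    (formulaConsts φ).Finite := by
  induction φ with
  | falsum => exact Set.finite_empty
  | equal s t => exact (finite_termConsts s).union (finite_termConsts t)
  | rel R ts => exact Set.finite_iUnion fun i => finite_termConsts (ts i)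
  | imp φ ψ h₁ h₂ => exact h₁.union h₂
  | all φ h => exact h

omit [LinearOrder 𝒰] in
-- In the reversed word each fact is a header followed by its constants; filtering out the header
-- letters leaves the constants. This explains the reversed list.
theorem PolyFun.constants {D : α → List (Fact S 𝒰)}
    (hD : PolyFun tm g fun a => (D a).flatMap (IncCQA.codeFact enc)) :
    PolyFun tm g fun a =>
      ((D a).reverse.flatMap fun f => List.ofFn f.2).flatMap (encodeConst S enc) := by
  have h := PolyFun.filter (tm := tm) (g := g) (e := fun _ => true) (code := fun c => [c])
    (L := fun a => ((D a).flatMap (IncCQA.codeFact enc)).reverse)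
    (p := fun _ c => isHeader c = false) (fun b => ⟨[], b, rfl, by simp, rfl⟩)
    (fun _ _ => inferInstance) (by simpa using hD.reverse)
    ((PolyFun.top.headPred fun c => ∃ l, c = some l ∧ isHeader l = false).congr fun q => by simp)
  convert h using 2 with a
  rw [List.flatMap_singleton', List.reverse_flatMap, List.filter_flatMap, List.flatMap_assoc]
  congr 1
  funext f
  have : ∀ l ∈ encodeTuple S enc f.2, decide (isHeader l = false) = true := fun l hl => by
    simpa using isHeader_encodeTuple hl
  simp only [Function.comp_apply, IncCQA.codeFact, List.reverse_reverse, encodeFact,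
    List.filter_cons, List.filter_eq_self.mpr this]
  rfl

theorem PolyPred.activeTrue (henc : Function.Injective enc) (hlt : DecidesLT S enc tm)
    (φ : (lang S 𝒰).Sentence) {D : α → List (Fact S 𝒰)} {D' : α → Instance S 𝒰}
    (hD' : ∀ a f, f ∈ D' a ↔ f ∈ D a)
    (hD : PolyFun tm g fun a => (D a).flatMap (IncCQA.codeFact enc)) :
    PolyPred tm g fun a => ActiveTrue (D' a) φ := by
  have hcs := finite_formulaConsts φ
  have := realizeOn henc hlt φ (v := fun _ => Fin.elim0)
    -- The constants of `φ` do not depend on the input, so they contribute a fixed word.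
    (E := fun a => ((D a).reverse.flatMap fun f => List.ofFn f.2) ++ hcs.toFinset.toList) hD' hD
    (by simpa using hD.constants.append (.const _)) fun i => i.elim0
  refine this.congr fun a => ?_
  rw [ActiveTrue]
  convert Iff.rfl using 2
  ext c
  simp [activeDomain, hD', List.mem_ofFn]

theorem PolyPred.consistent (henc : Function.Injective enc) (hlt : DecidesLT S enc tm)
    (IC : List (DenialConstraint S 𝒰)) {D : α → List (Fact S 𝒰)} {D' : α → Instance S 𝒰}
    (hD' : ∀ a f, f ∈ D' a ↔ f ∈ D a)
    (hD : PolyFun tm g fun a => (D a).flatMap (IncCQA.codeFact enc)) :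
    PolyPred tm g fun a => Consistent ActiveTrue IC (D' a) := by
  induction IC with
  | nil => exact (PolyPred.const True).congr fun a => by simp [Consistent]
  | cons κ IC ih =>
    exact ((activeTrue henc hlt κ.toSentence hD' hD).and ih).congr fun a => by simp [Consistent]

omit [LinearOrder 𝒰] in
theorem PolyFun.eraseFact [DecidableEq (Fact S 𝒰)] (henc : Function.Injective enc)
    {D : α → List (Fact S 𝒰)} {f : α → Fact S 𝒰}
    (hD : PolyFun tm g fun a => (D a).flatMap (IncCQA.codeFact enc))
    (hf : PolyFun tm g fun a => IncCQA.codeFact enc (f a)) :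
    PolyFun tm g fun a => ((D a).filter fun d => d ≠ f a).flatMap (IncCQA.codeFact enc) :=
  PolyFun.filter (p := fun a d => d ≠ f a) endsWith_codeFact (fun _ _ => inferInstance) hD
    ((PolyFun.top.eqPred ((PolyFun.comap hf Prod.fst).weaken _)).not.congr fun _ =>
      not_congr (codeFact_injective henc).eq_iff)

omit [LinearOrder 𝒰] in
-- The program consists of `k` nested loops over the facts, which is polynomial because `k` is
-- fixed.
theorem PolyPred.afterDeletion [DecidableEq (Fact S 𝒰)] (henc : Function.Injective enc)
    {P : Instance S 𝒰 → Prop}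
    (hP : ∀ (α : Type) (g : α → List (List (Letter S))) (D : α → List (Fact S 𝒰)),
      PolyFun tm g (fun a => (D a).flatMap (IncCQA.codeFact enc)) →
        PolyPred tm g fun a => P (D a).toFinset) (k : ℕ) :
    ∀ {α : Type} {g : α → List (List (Letter S))} {D : α → List (Fact S 𝒰)},
      PolyFun tm g (fun a => (D a).flatMap (IncCQA.codeFact enc)) →
        PolyPred tm g fun a => AfterDeletion P k (D a) := by
  induction k with
  | zero => exact fun hD => hP _ _ _ hD
  | succ k ih =>
    intro α g D hD
    refine PolyPred.exists_mem (p := fun a d => AfterDeletion P k ((D a).filter fun f => f ≠ d))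
      endsWith_codeFact hD ?_
    exact ih (PolyFun.eraseFact henc ((PolyFun.comap hD Prod.fst).weaken _) PolyFun.top)

end Evaluation

end

section

/-! ### Updates in polynomial time -/

section Updating

variable {S : Schema} {𝒰 : Type} {enc : 𝒰 → List Bool} {tm : FinTM2} {α : Type}
  {g : α → List (List (Letter S))}

/-- The effect of an update operation on a list of facts. -/
def updateList [DecidableEq (Fact S 𝒰)] (D : List (Fact S 𝒰)) : Update S 𝒰 → List (Fact S 𝒰)
  | .insert f => D ++ [f]
  | .delete f => D.filter fun d => d ≠ f
  | .change f A c =>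
      if f ∈ D then (D.filter fun d => d ≠ f) ++ [⟨f.1, Function.update f.2 A c⟩] else D

theorem toFinset_foldl_updateList [DecidableEq (Fact S 𝒰)] (U : List (Update S 𝒰))
    (D : List (Fact S 𝒰)) :
    (U.foldl updateList D).toFinset = applyUpdates U D.toFinset := by
  have hstep : ∀ (D : List (Fact S 𝒰)) (u : Update S 𝒰),
      (updateList D u).toFinset = Update.apply D.toFinset u := by
    rintro D (f | f | ⟨f, A, c⟩)
    · ext d
      simp [updateList, Update.apply]
    · ext d
      simp [updateList, Update.apply, and_comm]
    · ext d
      by_cases hf : f ∈ D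
      · simp [updateList, Update.apply, hf, and_comm, or_comm]
      · simp [updateList, Update.apply, hf]
  unfold applyUpdates
  induction U generalizing D with
  | nil => rfl
  | cons u U ih => rw [List.foldl_cons, List.foldl_cons, ih, hstep]

/-- The `i`-th constant in a sequence of words for constants. -/
def nthConst (i : ℕ) (w : List (Letter S)) : List (Letter S) :=
  headItem isSep ((tailItem isSep)^[i] w)

theorem nthConst_flatMap (l : List 𝒰) (i : ℕ) (hi : i < l.length) :
    nthConst i (l.flatMap (encodeConst S enc)) = encodeConst S enc l[i] := by
  induction i generalizing l with
  | zero =>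
    cases l with
    | nil => simp at hi
    | cons a l => exact (headItem_encodeConst a _).1
  | succ i ih =>
    cases l with
    | nil => simp at hi
    | cons a l =>
      have := ih l (by simpa using hi)
      simpa [nthConst, (headItem_encodeConst a _).2] using this

theorem PolyFun.nthConst {w : α → List (Letter S)} (h : PolyFun tm g w) (i : ℕ) :
    PolyFun tm g fun a => nthConst i (w a) := by
  refine PolyFun.headItem isSep ?_
  induction i with
  | zero => exact h
  | succ i ih =>
    simp only [Function.iterate_succ_apply']
    exact ih.tailItem isSep

/-- The word for a fact whose constants are picked from a sequence of constants. -/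
def pickFact (r : S.Rel) (p : Fin (S.arity r) → ℕ) (w : List (Letter S)) : List (Letter S) :=
  (Letter.fact r :: (List.ofFn fun i => nthConst (p i) w).flatten).reverse

theorem PolyFun.pickFact {w : α → List (Letter S)} (h : PolyFun tm g w) (r : S.Rel)
    (p : Fin (S.arity r) → ℕ) : PolyFun tm g fun a => pickFact r p (w a) :=
  ((PolyFun.const [Letter.fact r]).append (PolyFun.flatten_ofFn fun i => h.nthConst (p i))).reverse

/-- The arguments of a change are the old tuple and then the new value. Counting from 0, the latter
has position `S.arity f.1`, and picking it in place of the entry `A` gives the changed fact. -/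
theorem pickFact_eq (f : Fact S 𝒰) (A : Fin (S.arity f.1)) (c : 𝒰) :
    pickFact f.1 (fun i => i) (encodeTuple S enc f.2 ++ encodeConst S enc c) = codeFact enc f ∧
    pickFact f.1 (fun i => if i = A then S.arity f.1 else i)
      (encodeTuple S enc f.2 ++ encodeConst S enc c) =
        codeFact enc ⟨f.1, Function.update f.2 A c⟩ := by
  have h : encodeTuple S enc f.2 ++ encodeConst S enc c =
      (List.ofFn f.2 ++ [c]).flatMap (encodeConst S enc) := by simp [encodeTuple]
  rw [h]
  constructor
  · rw [pickFact, codeFact, encodeFact, encodeTuple_eq]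
    congr 5
    funext i
    rw [nthConst_flatMap _ _ (by simp), List.getElem_append_left (by simp)]
    simp
  · rw [pickFact, codeFact, encodeFact, encodeTuple_eq]
    congr 5
    funext i
    by_cases hi : i = A
    · subst hi
      simp only [if_true]
      rw [nthConst_flatMap _ _ (by simp)]
      simp
    · simp only [hi, if_false]
      rw [nthConst_flatMap _ _ (by simp), List.getElem_append_left (by simp)]
      simp [hi]

theorem PolyFun.updateList [DecidableEq (Fact S 𝒰)] (henc : Function.Injective enc)
    {D : α → List (Fact S 𝒰)} {u : α → Update S 𝒰}
    (hD : PolyFun tm g fun a => (D a).flatMap (IncCQA.codeFact enc))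
    (hu : PolyFun tm g fun a => codeUpdate enc (u a)) :
    PolyFun tm g fun a => (updateList (D a) (u a)).flatMap (IncCQA.codeFact enc) := by
  classical
  have hz : PolyFun tm g fun a => encodeUpdate enc (u a) := by
    simpa [codeUpdate] using hu.reverse
  have hargs : PolyFun tm g fun a => (encodeUpdate enc (u a)).tail := by
    simpa [tailItem_true] using hz.tailItem fun _ => true
  have herase : ∀ {w : α → List (Letter S)}, PolyFun tm g w → PolyFun tm g fun a =>
      ((D a).filter fun d => IncCQA.codeFact enc d ≠ w a).flatMap (IncCQA.codeFact enc) :=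
    fun hw => PolyFun.filter (p := fun a d => IncCQA.codeFact enc d ≠ _) endsWith_codeFact
      (fun _ _ => inferInstance) hD
      (PolyFun.top.eqPred ((PolyFun.comap hw Prod.fst).weaken _)).not
  have hmem : ∀ {w : α → List (Letter S)}, PolyFun tm g w → PolyPred tm g fun a =>
      ∃ d ∈ D a, IncCQA.codeFact enc d = w a :=
    fun hw => PolyPred.exists_mem (p := fun a d => IncCQA.codeFact enc d = _) endsWith_codeFact
      hD (PolyFun.top.eqPred ((PolyFun.comap hw Prod.fst).weaken _))
  have hfact : ∀ r : S.Rel, PolyFun tm g fun a =>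
      (Letter.fact r :: (encodeUpdate enc (u a)).tail).reverse := fun r =>
    ((PolyFun.const [Letter.fact r]).append hargs).reverse
  -- Each branch must make sense for every `a`, also if its letter is not the header of `u a` and
  -- the arguments do not code a tuple for `r`. The branches are therefore formulated with words
  -- instead of facts.
  have := PolyFun.switch hz (y := fun _ => []) (X := fun c a => match c with
    | .insert r => (D a).flatMap (IncCQA.codeFact enc) ++
        (Letter.fact r :: (encodeUpdate enc (u a)).tail).reverse
    | .delete r => ((D a).filter fun d => IncCQA.codeFact enc d ≠
        (Letter.fact r :: (encodeUpdate enc (u a)).tail).reverse).flatMap (IncCQA.codeFact enc)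
    | .change r A =>
      if ∃ d ∈ D a, IncCQA.codeFact enc d =
          IncCQA.pickFact r (fun i => i) (encodeUpdate enc (u a)).tail then
        ((D a).filter fun d => IncCQA.codeFact enc d ≠
          IncCQA.pickFact r (fun i => i) (encodeUpdate enc (u a)).tail).flatMap
            (IncCQA.codeFact enc) ++
          IncCQA.pickFact r (fun i => if i = A then S.arity r else i)
            (encodeUpdate enc (u a)).tail
      else (D a).flatMap (IncCQA.codeFact enc)
    | _ => []) (fun c => ?_) (.const [])
  · convert this using 2 with a
    rcases hua : u a with f | f | ⟨f, A, c⟩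
    · simp [encodeUpdate, IncCQA.updateList, IncCQA.codeFact, encodeFact]
    · have : ∀ d : Fact S 𝒰, IncCQA.codeFact enc d =
          (Letter.fact f.1 :: encodeTuple S enc f.2).reverse ↔ d = f :=
        fun d => (codeFact_injective henc).eq_iff (b := f)
      simp only [encodeUpdate, IncCQA.updateList, List.head?_cons, Option.elim_some,
        List.tail_cons, ne_eq, this]
    · simp only [encodeUpdate, IncCQA.updateList, List.head?_cons, Option.elim_some,
        List.tail_cons, (pickFact_eq f A c).1, (pickFact_eq f A c).2,
        (codeFact_injective henc).eq_iff, ne_eq, exists_eq_right]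
      by_cases hf : f ∈ D a
      · simp only [hf, if_true, List.flatMap_append, List.flatMap_singleton]
      · simp only [hf, if_false]
  · cases c with
    | insert r => exact hD.append (hfact r)
    | delete r => exact herase (hfact r)
    | change r A =>
      exact (hmem (hargs.pickFact r _)).ite ((herase (hargs.pickFact r _)).append
        (hargs.pickFact r _)) hD fun _ => inferInstance
    | _ => exact .const []

/-- An update lengthens the instance by at most its own code, so all intermediate instances stay
linear in the input, as the fold over the updates requires. -/
theorem length_updateList_le [DecidableEq (Fact S 𝒰)] (D : List (Fact S 𝒰)) (u : Update S 𝒰) :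
    ((updateList D u).flatMap (codeFact enc)).length ≤
      (D.flatMap (codeFact enc)).length + (codeUpdate enc u).length := by
  have hfil : ∀ f, ((D.filter fun d => d ≠ f).flatMap (codeFact enc)).length ≤
      (D.flatMap (codeFact enc)).length := fun f =>
    (List.filter_sublist.flatMap (codeFact enc)).length_le
  rcases u with f | f | ⟨f, A, c⟩
  · simp [updateList, codeUpdate, encodeUpdate, codeFact, encodeFact]
  · exact (hfil f).trans (Nat.le_add_right _ _)
  · have h1 : (encodeTuple S enc (Function.update f.2 A c)).length ≤
        (encodeTuple S enc f.2).length + (encodeConst S enc c).length := by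
      simp only [encodeTuple_eq, List.length_flatten, List.map_ofFn, List.sum_ofFn,
        Function.comp_apply]
      have h2 : ∀ i, (encodeConst S enc (Function.update f.2 A c i)).length ≤
          (encodeConst S enc (f.2 i)).length +
            if i = A then (encodeConst S enc c).length else 0 := by
        intro i
        by_cases hi : i = A
        · subst hi; simp
        · simp [hi]
      refine (Finset.sum_le_sum fun i _ => h2 i).trans ?_
      simp [Finset.sum_add_distrib]
    have := hfil f
    by_cases hf : f ∈ D
    · simp only [updateList, hf, if_true, List.flatMap_append, List.length_append,
        List.flatMap_singleton, codeUpdate, encodeUpdate, codeFact, encodeFact,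
        List.length_reverse, List.length_cons] at this ⊢
      omega
    · simp [updateList, hf]

theorem PolyFun.updates [DecidableEq (Fact S 𝒰)] (henc : Function.Injective enc)
    {D : α → List (Fact S 𝒰)} {U : α → List (Update S 𝒰)}
    (hD : PolyFun tm g fun a => (D a).flatMap (IncCQA.codeFact enc))
    (hU : PolyFun tm g fun a => (U a).flatMap (codeUpdate enc)) :
    PolyFun tm g fun a => ((U a).foldl IncCQA.updateList (D a)).flatMap (IncCQA.codeFact enc) := by
  have hlen : ∀ (U : List (Update S 𝒰)) (D : List (Fact S 𝒰)),
      ((U.foldl IncCQA.updateList D).flatMap (IncCQA.codeFact enc)).length ≤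
        (D.flatMap (IncCQA.codeFact enc)).length + (U.flatMap (codeUpdate enc)).length := by
    intro U
    induction U with
    | nil => simp
    | cons u U ih =>
      intro D
      have h1 := ih (IncCQA.updateList D u)
      have h2 := length_updateList_le (enc := enc) D u
      simp only [List.foldl_cons, List.flatMap_cons, List.length_append]
      omega
  refine PolyFun.fold isHeader (codeUpdate enc) endsWith_codeUpdate
    (fun D : List (Fact S 𝒰) => D.flatMap (IncCQA.codeFact enc)) (L := U) (init := D)
    (step := fun _ u D => IncCQA.updateList D u) hU hD
    (PolyFun.updateList henc ((PolyFun.top.weaken _).weaken _) PolyFun.top) .X fun a l₁ l₂ h => ?_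
  refine (hlen l₁ (D a)).trans ?_
  rw [h]
  simp only [List.flatMap_append, size_cons, List.length_append, Polynomial.eval_X]
  omega

end Updating

/-! ### The decision procedure -/

section Decision

variable {S : Schema} {𝒰 : Type} {enc : 𝒰 → List Bool} {tm : FinTM2}

/-- The word for a tuple of the instance or an update operation. -/
def codeToken (enc : 𝒰 → List Bool) : Fact S 𝒰 ⊕ Update S 𝒰 → List (Letter S) :=
  Sum.elim (codeFact enc) (codeUpdate enc)

/-- The tuples and the update operations of an input, in reversed order. -/
def tokens (x : Input S 𝒰) : List (Fact S 𝒰 ⊕ Update S 𝒰) :=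
  (x.1.map Sum.inl ++ x.2.map Sum.inr).reverse

theorem endsWith_codeToken : EndsWith isHeader (codeToken (S := S) enc)
  | .inl f => endsWith_codeFact f
  | .inr u => endsWith_codeUpdate u

theorem reverse_encodeInput (x : Input S 𝒰) :
    (encodeInput enc x).reverse = (tokens x).flatMap (codeToken enc) := by
  simp only [tokens, encodeInput, List.reverse_append, List.flatMap_append, List.reverse_flatMap,
    ← List.map_reverse, List.flatMap_map]
  rfl

theorem PolyPred.isLeft {α : Type} {g : α → List (List (Letter S))}
    {b : α → Fact S 𝒰 ⊕ Update S 𝒰} (h : PolyFun tm g fun a => codeToken enc (b a)) :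
    PolyPred tm g fun a => (b a).isLeft = true := by
  refine (h.reverse.headPred fun c => ∃ r, c = some (Letter.fact r)).congr fun a => ?_
  rcases b a with f | f | f | f <;>
    simp [codeToken, codeFact, codeUpdate, encodeFact, encodeUpdate]

/-- The reversed input is a list of tokens, distinguished by their headers. The facts come out in
reversed order, which is immaterial for the instance. -/
theorem PolyFun.inputFacts : PolyFun tm (fun x : Input S 𝒰 => [(encodeInput enc x).reverse])
    fun x => x.1.reverse.flatMap (IncCQA.codeFact enc) := by
  have h := PolyFun.filter (tm := tm) (g := fun x : Input S 𝒰 => [(encodeInput enc x).reverse])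
    (L := tokens) (code := codeToken enc) (p := fun _ b => b.isLeft = true) endsWith_codeToken
    (fun _ _ => inferInstance) (by simpa only [reverse_encodeInput] using PolyFun.top)
    (PolyPred.isLeft PolyFun.top)
  convert h using 2 with x
  simp [tokens, List.filter_map, Function.comp_def, ← List.map_reverse, List.flatMap_map,
    codeToken]

/-- The order of the updates matters, so the filtered list is reversed once more. -/
theorem PolyFun.inputUpdates : PolyFun tm (fun x : Input S 𝒰 => [(encodeInput enc x).reverse])
    fun x => x.2.flatMap (codeUpdate enc) := by
  have h := PolyFun.filter (tm := tm) (g := fun x : Input S 𝒰 => [(encodeInput enc x).reverse])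
    (L := tokens) (code := codeToken enc) (p := fun _ b => ¬ b.isLeft = true) endsWith_codeToken
    (fun _ _ => inferInstance) (by simpa only [reverse_encodeInput] using PolyFun.top)
    (PolyPred.isLeft PolyFun.top).not
  have h2 := PolyFun.reverseList (L := fun x : Input S 𝒰 => x.2.reverse)
    (code := codeUpdate enc) endsWith_codeUpdate (tm := tm)
    (g := fun x : Input S 𝒰 => [(encodeInput enc x).reverse]) (by
      convert h using 2 with x
      simp [tokens, List.filter_map, Function.comp_def, ← List.map_reverse, List.flatMap_map,
        codeToken])
  simpa using h2

theorem inPTIME_incrementalCQA [LinearOrder 𝒰] (henc : Function.Injective enc)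
    (hlt : InPTIME (encodePair enc) fun p : 𝒰 × 𝒰 => p.1 < p.2)
    (IC : List (DenialConstraint S 𝒰)) (Q : (lang S 𝒰).Sentence) (m : ℕ) :
    InPTIME (encodeInput enc) (IncrementalCQA ActiveTrue IC Q m) := by
  have inst : DecidableEq (Fact S 𝒰) := Classical.decEq _
  obtain ⟨tm, htm⟩ := exists_decidesLT S hlt
  have hD := PolyFun.inputFacts (tm := tm) (enc := enc) (S := S)
  have hU := PolyFun.inputUpdates (tm := tm) (enc := enc) (S := S)
  have hL := hD.updates henc hU
  have hcons : ∀ k, PolyPred tm _ _ := fun k => PolyPred.afterDeletion henc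
    (P := Consistent ActiveTrue IC)
    (fun α g D h => PolyPred.consistent henc htm IC (fun a f => List.mem_toFinset) h) k hL
  have hbad : ∀ k, PolyPred tm _ _ := fun k => PolyPred.afterDeletion henc
    (P := fun D => Consistent ActiveTrue IC D ∧ ¬ ActiveTrue D Q)
    (fun α g D h => (PolyPred.consistent henc htm IC (fun a f => List.mem_toFinset) h).and
      (PolyPred.activeTrue henc htm Q (fun a f => List.mem_toFinset) h).not) k hL
  -- The bound `m + 1` includes `k = m`: all `m` updates may have to be undone by deletions.
  have hlast := PolyPred.forall_lt (fun k => (PolyPred.exists_lt hcons k).or (hbad k).not) (m + 1)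
  have hfirst := PolyPred.consistent henc htm IC (D' := fun x : Input S 𝒰 => x.1.toFinset)
    (fun a f => by simp) hD
  refine inPTIME_of_polyFun _ _ Letter.sep ((hfirst.and
    ((PolyPred.length_eq endsWith_codeUpdate hU m).and hlast)).congr fun x => ?_)
  rw [incrementalCQA_iff IC Q m x (x.2.foldl updateList x.1.reverse)
    (by rw [toFinset_foldl_updateList, List.toFinset_reverse])]
  simp only [Nat.lt_succ_iff]

end Decision

end

end IncCQA

theorem mainTheorem4 (S : IncCQA.Schema) (𝒰 : Type) [LinearOrder 𝒰]
    (enc : 𝒰 → List Bool) (henc : Function.Injective enc)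
    (hlt : IncCQA.InPTIME (IncCQA.encodePair enc) (fun p : 𝒰 × 𝒰 => p.1 < p.2))
    (IC : List (IncCQA.DenialConstraint S 𝒰)) (Q : (IncCQA.lang S 𝒰).Sentence) (m : ℕ) :
    IncCQA.InPTIME (IncCQA.encodeInput enc)
        (IncCQA.IncrementalCQA IncCQA.ActiveTrue IC Q m) ∧
      ((∀ κ ∈ IC, IncCQA.DomainIndependent κ.toSentence) → IncCQA.DomainIndependent Q →
        IncCQA.InPTIME (IncCQA.encodeInput enc)
          (IncCQA.IncrementalCQA IncCQA.NaturalTrue IC Q m)) := by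
  have h := IncCQA.inPTIME_incrementalCQA henc hlt IC Q m
  refine ⟨h, fun hIC hQ => ?_⟩
  rwa [show IncCQA.IncrementalCQA IncCQA.NaturalTrue IC Q m =
    IncCQA.IncrementalCQA IncCQA.ActiveTrue IC Q m from
      funext fun x => propext (IncCQA.incrementalCQA_natural_iff hIC hQ m x)]
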